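/- Let $X$ and $S$ be real analytic manifolds (finite-dimensional, Hausdorff, second countable). Let $\mathrm{op}(X_{sa})$ be the set of subanalytic open subsets of $X$; a family $T$ of subanalytic open subsets of $U\in\mathrm{op}(X_{sa})$ is a covering of $U$ in $X_{sa}$ if for every compact $K\subset X$ there is a finite $T_0\subset T$ with $K\cap\bigcup_{U'\in T_0}U'=K\cap U$. Let $\mathrm{op}(S)$ be the set of open subsets of $S$, with the usual open coverings. The relative site $X_{sa}\times S$ is defined as follows. Its objects are the finite unions of products $U\times V$ with $U\in\mathrm{op}(X_{sa})$, $V\in\mathrm{op}(S)$, ordered by inclusion. A family $T$ of objects contained in an object $W$ is a covering of $W$ if, for every product $U\times V\subset W$ with $U\in\mathrm{op}(X_{sa})$ and $V\in\mathrm{op}(S)$, the family $\{W'\cap(U\times V): W'\in T\}$ has a refinement $\{U_i\times V_j\}_{i\in I,j\in J}$ with $\{U_i\}_{i\in I}$ a covering of $U$ in $X_{sa}$ and $\{V_j\}_{j\in J}$ an open covering of $V$. Let $\mathrm{Mod}(\mathbb{C}_{X_{sa}\times S})$ be the abelian category of sheaves of $\mathbb{C}$-vector spaces for the Grothendieck topology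 generated by these coverings. For objects $V\subset W$, say that $V$ is weakly quasi-compact in $W$, written $V\overset{wc}{\to}W$, if for every covering $T$ of $W$ the family $\{W'\cap V: W'\in T\}$ has a finite refinement that is a covering of $V$. A sheaf $F$ on $X_{sa}\times S$ is c-soft if, for all objects $Y,V,W$ with $V\overset{wc}{\to}Y$, $W\overset{wc}{\to}Y$ and $V\overset{wc}{\to}W$, the natural map $$\Gamma(W;F)\longrightarrow\varinjlim_{V\overset{wc}{\to}U}\Gamma(U;F)$$ is surjective. Then for every $U\in\mathrm{op}(X_{sa})$ and $V\in\mathrm{op}(S)$ the family of c-soft sheaves is injective with respect to the functor $\Gamma(U\times V;\bullet)$ on $\mathrm{Mod}(\mathbb{C}_{X_{sa}\times S})$. That is: 1. $0$ is c-soft, and direct sums of two c-soft sheaves are c-soft; 2. every sheaf embeds into a c-soft sheaf; 3. if $0\to F'\to F\to F''\to 0$ is exact with $F'$ and $F$ c-soft, then $F''$ is c-soft; 4. if $0\to F'\to F\to F''\to 0$ is exact with $F'$ c-soft, then $0\to\Gamma(U\times V;F')\to\Gamma(U\times V;F)\to\Gamma(U\times V;F'')\to 0$ is exact. Consequently every c-soft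 sheaf $F$ is $\Gamma(U\times V;\bullet)$-acyclic: $R^n\Gamma(U\times V;F)=0$ for all $n\ge 1$. -/

import Mathlib

open CategoryTheory CategoryTheory.Limits TopologicalSpace Opposite
open scoped Manifold ContDiff ZeroObject

universe u v w

noncomputable section

/-! The following two instances give, in every universe, that complex vector spaces admit
sheafification and that sheaves of complex vector spaces form a Grothendieck abelian category. -/

instance preservesFilteredColimits_forget_moduleCat :
    PreservesFilteredColimits (forget (ModuleCat.{u} ℂ)) :=
  Limits.comp_preservesFilteredColimits (forget₂ (ModuleCat.{u} ℂ) AddCommGrpCat.{u})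
    (forget AddCommGrpCat.{u})

instance isGrothendieckAbelian_moduleCat :
    IsGrothendieckAbelian.{u} (ModuleCat.{u} ℂ) :=
  IsGrothendieckAbelian.of_equivalence
    (ModuleCat.restrictScalarsEquivalenceOfRingEquiv
      (ULift.ringEquiv.symm : ℂ ≃+* ULift.{u} ℂ))

/-- A subset `A` of a real analytic manifold `M` is semianalytic if every point of `M` has an open
neighbourhood `U` on which `A` is a finite union of sets, each defined by finitely many equations
`f = 0` and finitely many strict inequalities `g > 0` with `f`, `g` real analytic on `U`. -/
def IsSemianalytic {E H : Type*} [NormedAddCommGroup E] [NormedSpace ℝ E] [TopologicalSpace H]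
    (I : ModelWithCorners ℝ E H) {M : Type*} [TopologicalSpace M] [ChartedSpace H M]
    (A : Set M) : Prop :=
  ∀ x : M, ∃ U : Set M, IsOpen U ∧ x ∈ U ∧
    ∃ (n m : ℕ) (f g : Fin n → Fin m → M → ℝ),
      (∀ i j, ContMDiffOn I 𝓘(ℝ, ℝ) ω (f i j) U) ∧
      (∀ i j, ContMDiffOn I 𝓘(ℝ, ℝ) ω (g i j) U) ∧
      A ∩ U = {y ∈ U | ∃ i, (∀ j, f i j y = 0) ∧ (∀ j, 0 < g i j y)}

/-- A subset `A` of a real analytic manifold `X` (modelled on `E`) is subanalytic if every point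
of `X` has an open neighbourhood `U` such that `A ∩ U` is the projection to `X` of a relatively
compact semianalytic subset of `X × ℝᵈ` for some `d`. -/
def IsSubanalytic (E : Type*) [NormedAddCommGroup E] [NormedSpace ℝ E]
    {X : Type*} [TopologicalSpace X] [ChartedSpace E X] (A : Set X) : Prop :=
  ∀ x : X, ∃ U : Set X, IsOpen U ∧ x ∈ U ∧
    ∃ (d : ℕ) (B : Set (X × EuclideanSpace ℝ (Fin d))),
      IsSemianalytic (𝓘(ℝ, E).prod 𝓘(ℝ, EuclideanSpace ℝ (Fin d))) B ∧
      IsCompact (closure B) ∧ A ∩ U = Prod.fst '' B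

/-- Coverings in the subanalytic site `X_sa`: a family `T` of subanalytic open subsets of `U`
covers `U` if for every compact `K ⊆ X` some finite subfamily has the same trace on `K`
as `U`. -/
def IsSaCovering (E : Type*) [NormedAddCommGroup E] [NormedSpace ℝ E]
    {X : Type*} [TopologicalSpace X] [ChartedSpace E X] (U : Opens X) (T : Set (Opens X)) : Prop :=
  (∀ U' ∈ T, IsSubanalytic E (U' : Set X) ∧ U' ≤ U) ∧
  ∀ K : Set X, IsCompact K → ∃ T₀ ⊆ T, T₀.Finite ∧
    K ∩ (⋃ U' ∈ T₀, (U' : Set X)) = K ∩ (U : Set X)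

/-- `op(X_sa × S)`: the finite unions of products `U × V`, with `U` a subanalytic open subset
of `X` and `V` an open subset of `S`. It is ordered by inclusion, and regarded as a category
through this order. -/
abbrev RelOpen (E : Type*) [NormedAddCommGroup E] [NormedSpace ℝ E]
    (X : Type u) [TopologicalSpace X] [ChartedSpace E X]
    (S : Type v) [TopologicalSpace S] : Type (max u v) :=
  {W : Opens (X × S) // ∃ P : Set (Opens X × Opens S), P.Finite ∧
    (∀ p ∈ P, IsSubanalytic E (p.1 : Set X)) ∧
    (W : Set (X × S)) = ⋃ p ∈ P, (p.1 : Set X) ×ˢ (p.2 : Set S)}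

section RelativeSite

variable (E : Type w) [NormedAddCommGroup E] [NormedSpace ℝ E]
  {X : Type u} [TopologicalSpace X] [ChartedSpace E X] {S : Type v} [TopologicalSpace S]

/-- The product `U × V` as an object of `op(X_sa × S)`. -/
def RelOpen.box (U : Opens X) (hU : IsSubanalytic E (U : Set X)) (V : Opens S) :
    RelOpen E X S :=
  ⟨⟨(U : Set X) ×ˢ (V : Set S), U.isOpen.prod V.isOpen⟩, {(U, V)}, Set.finite_singleton _, by simpa using hU, by simp⟩

variable {E}

/-- The family `T` has a refinement `{U' × V'}` over the product `U × V`, where `U'` runs over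
a covering of `U` in `X_sa` and `V'` over an open covering of `V` in `S`. -/
def RefinedByProductCovering (T : Set (RelOpen E X S)) (U : Opens X) (V : Opens S) : Prop :=
  ∃ (𝒰 : Set (Opens X)) (𝒱 : Set (Opens S)), IsSaCovering E U 𝒰 ∧ sSup 𝒱 = V ∧
    ∀ U' ∈ 𝒰, ∀ V' ∈ 𝒱, ∃ A ∈ T, (U' : Set X) ×ˢ (V' : Set S) ⊆ (A.1 : Set (X × S))

/-- Coverings in `X_sa × S`: a family `T` of objects contained in `W` covers `W` if, for every
product `U × V ⊆ W` with `U` subanalytic open in `X` and `V` open in `S`, the trace of `T` on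
`U × V` is refined by a product covering of `U × V`. (Members of such a product covering lie
in `U × V`, so lying in a member of the trace of `T` amounts to lying in a member of `T`.) -/
def IsRelCovering (W : RelOpen E X S) (T : Set (RelOpen E X S)) : Prop :=
  (∀ A ∈ T, A ≤ W) ∧
  ∀ (U : Opens X) (V : Opens S), IsSubanalytic E (U : Set X) →
    (U : Set X) ×ˢ (V : Set S) ⊆ (W.1 : Set (X × S)) → RefinedByProductCovering T U V

/-- `V` is weakly quasi-compact in `W`: `V ⊆ W`, and the trace on `V` of any covering of `W`
has a finite refinement covering `V`. -/
def IsWC (V W : RelOpen E X S) : Prop :=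
  V ≤ W ∧ ∀ T, IsRelCovering W T →
    ∃ T' : Set (RelOpen E X S), T'.Finite ∧ IsRelCovering V T' ∧ ∀ A ∈ T', ∃ B ∈ T, A ≤ B

variable (E X S)

/-- The coverings of `X_sa × S`, as presieves. -/
def relPrecoverage : Precoverage (RelOpen E X S) where
  coverings W := {R | IsRelCovering W {A | ∃ f : A ⟶ W, R f}}

/-- The Grothendieck topology generated by the coverings of `X_sa × S`. -/
def relTopology : GrothendieckTopology (RelOpen E X S) := (relPrecoverage E X S).toGrothendieck

/-- `Mod(ℂ_{X_sa × S})`, the category of sheaves of complex vector spaces on `X_sa × S`. -/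
abbrev RelSheaf := Sheaf (relTopology E X S) (ModuleCat.{max u v} ℂ)

variable {E X S}

/-- The functor `Γ(W; •)` of sections on `W`. -/
abbrev relSections (W : RelOpen E X S) : RelSheaf E X S ⥤ ModuleCat.{max u v} ℂ :=
  (sheafSections (relTopology E X S) (ModuleCat.{max u v} ℂ)).obj (op W)

instance relSections_additive (W : RelOpen E X S) : (relSections W).Additive where
  map_add := rfl

/-- The inductive system `U ↦ Γ(U; F)`, indexed by the objects `U` in which `V` is
weakly quasi-compact. -/
def wcSystem (F : RelSheaf E X S) (V : RelOpen E X S) :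
    {U : RelOpen E X S // IsWC V U}ᵒᵖ ⥤ ModuleCat.{max u v} ℂ :=
  (Subtype.mono_coe (fun U => IsWC V U)).functor.op ⋙ F.obj

/-- A sheaf `F` on `X_sa × S` is c-soft if `Γ(W; F) → colim_{V wc→ U} Γ(U; F)` is surjective
whenever `V` and `W` are weakly quasi-compact in some object `Y`, and `V` is weakly
quasi-compact in `W`. -/
def IsCSoft (F : RelSheaf E X S) : Prop :=
  ∀ (Y V W : RelOpen E X S), IsWC V Y → IsWC W Y → ∀ hVW : IsWC V W,
    Function.Surjective (colimit.ι (wcSystem F V) (op ⟨W, hVW⟩)).hom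

end RelativeSite

/-- A full additive subcategory of an abelian category, given by the property `P`, is injective
with respect to the additive functor `Φ`: it is cogenerating, contains the cokernel of every
monomorphism between its objects, and `Φ` preserves exactness of every short exact sequence whose
first term is in the subcategory. -/
structure IsInjectiveWrt {C : Type*} [Category C] [Abelian C] {D : Type*} [Category D]
    [Abelian D] (P : ObjectProperty C) (Φ : C ⥤ D) [Φ.Additive] : Prop where
  zero : P 0
  biprod : ∀ A B : C, P A → P B → P (A ⊞ B)
  cogenerating : ∀ A : C, ∃ (B : C) (i : A ⟶ B), P B ∧ Mono i
  quotient : ∀ T : ShortComplex C, T.ShortExact → P T.X₁ → P T.X₂ → P T.X₃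
  exact : ∀ T : ShortComplex C, T.ShortExact → P T.X₁ → (T.map Φ).ShortExact

end

/-!
Write `A ⋐ W` when `A` is weakly quasi-compact in `W`. Every object `W` is covered by products
`U × V ⋐ W` with `U` relatively compact and `V` contained in a compact set `K` such that
`U × K ⊆ W`. So if `A ⋐ W`, then finitely many of these cover `A`, and statements about `⋐` reduce
to compactness arguments in `S`; in particular `⋐` is stable under intersections and can be
interpolated. A sheaf `F` is therefore c-soft as soon as sections near `A` extend from `A` to `W`
whenever `A ⋐ W ⋐ Y`.

Let `0 → F' → F → F'' → 0` be exact with `F'` c-soft. A section of `F''` on `W` lifts locally, hence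
on each member of a finite family covering a given `A ⋐ W`; extending sections of `F'` allows one to
correct these lifts so that they glue on `A`. Second countability exhausts `W` by a sequence
`D 0 ⋐ D 1 ⋐ ⋯`, along which the lifts are corrected to converge to a lift on `W`. Injective sheaves
are c-soft because their restriction maps are surjective, so there are enough c-soft sheaves, and
the acyclicity follows by splitting an injective resolution into short exact sequences.
-/

section Subanalytic

section Semianalytic

variable {E H : Type*} [NormedAddCommGroup E] [NormedSpace ℝ E] [TopologicalSpace H]
  {I : ModelWithCorners ℝ E H} {M : Type*} [TopologicalSpace M] [ChartedSpace H M]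

theorem IsSemianalytic.inter {A B : Set M} (hA : IsSemianalytic I A) (hB : IsSemianalytic I B) :
    IsSemianalytic I (A ∩ B) := by
  intro x
  obtain ⟨U, hU, hxU, n, m, f, g, hf, hg, hAU⟩ := hA x
  obtain ⟨V, hV, hxV, n', m', f', g', hf', hg', hBV⟩ := hB x
  refine ⟨U ∩ V, hU.inter hV, ⟨hxU, hxV⟩, n * n', m + m',
    fun i => Fin.addCases (f (finProdFinEquiv.symm i).1) (f' (finProdFinEquiv.symm i).2),
    fun i => Fin.addCases (g (finProdFinEquiv.symm i).1) (g' (finProdFinEquiv.symm i).2),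
    fun i j => ?_, fun i j => ?_, ?_⟩
  · induction j using Fin.addCases with
    | left j => simpa using (hf _ j).mono Set.inter_subset_left
    | right j => simpa using (hf' _ j).mono Set.inter_subset_right
  · induction j using Fin.addCases with
    | left j => simpa using (hg _ j).mono Set.inter_subset_left
    | right j => simpa using (hg' _ j).mono Set.inter_subset_right
  · rw [Set.inter_inter_inter_comm, hAU, hBV]
    ext y
    simp only [Set.mem_inter_iff, Set.mem_ofPred_eq, Fin.forall_fin_add, Fin.addCases_left,
      Fin.addCases_right]
    rw [← finProdFinEquiv.exists_congr_right]
    simp only [Equiv.symm_apply_apply, Prod.exists]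
    constructor
    · rintro ⟨⟨hyU, i, hf, hg⟩, hyV, i', hf', hg'⟩
      exact ⟨⟨hyU, hyV⟩, i, i', ⟨hf, hf'⟩, hg, hg'⟩
    · rintro ⟨⟨hyU, hyV⟩, i, i', ⟨hf, hf'⟩, hg, hg'⟩
      exact ⟨⟨hyU, i, hf, hg⟩, hyV, i', hf', hg'⟩

theorem IsSemianalytic.preimage {E₂ H₂ : Type*} [NormedAddCommGroup E₂] [NormedSpace ℝ E₂]
    [TopologicalSpace H₂] {J : ModelWithCorners ℝ E₂ H₂} {N : Type*} [TopologicalSpace N]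
    [ChartedSpace H₂ N] {A : Set N} (hA : IsSemianalytic J A) {φ : M → N}
    (hφ : ContMDiff I J ω φ) : IsSemianalytic I (φ ⁻¹' A) := by
  intro x
  obtain ⟨U, hU, hxU, n, m, f, g, hf, hg, hAU⟩ := hA (φ x)
  refine ⟨φ ⁻¹' U, hU.preimage hφ.continuous, hxU, n, m, fun i j => f i j ∘ φ,
    fun i j => g i j ∘ φ, fun i j => (hf i j).comp hφ.contMDiffOn subset_rfl,
    fun i j => (hg i j).comp hφ.contMDiffOn subset_rfl, ?_⟩
  rw [← Set.preimage_inter, hAU]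
  rfl

theorem isSemianalytic_of_closure_subset {U A : Set M} (hU : IsOpen U) (hAU : closure A ⊆ U)
    {f : M → ℝ} (hf : ContMDiffOn I 𝓘(ℝ, ℝ) ω f U) (hA : ∀ y ∈ U, y ∈ A ↔ 0 < f y) :
    IsSemianalytic I A := by
  intro x
  by_cases hx : x ∈ U
  · refine ⟨U, hU, hx, 1, 1, fun _ _ _ => 0, fun _ _ => f, fun _ _ => contMDiffOn_const,
      fun _ _ => hf, ?_⟩
    ext y
    simp only [Set.mem_inter_iff, Set.mem_ofPred_eq, exists_const, forall_const, true_and,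
      and_comm (a := y ∈ A)]
    exact and_congr_right (hA y)
  · refine ⟨(closure A)ᶜ, isClosed_closure.isOpen_compl, fun h => hx (hAU h), 0, 0,
      fun i => i.elim0, fun i => i.elim0, fun i => i.elim0, fun i => i.elim0, ?_⟩
    ext y
    simpa using fun h => subset_closure h

end Semianalytic

/- Euclidean balls serve here: unlike the square of the given norm on `E`, that of a Euclidean
norm is analytic. -/
theorem exists_contDiff_pos_isCompact_nonneg {E : Type*} [NormedAddCommGroup E] [NormedSpace ℝ E]
    [FiniteDimensional ℝ E] {z : E} {V : Set E} (hV : V ∈ nhds z) :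
    ∃ g : E → ℝ, ContDiff ℝ ω g ∧ 0 < g z ∧ IsCompact {y | 0 ≤ g y} ∧ {y | 0 ≤ g y} ⊆ V := by
  obtain ⟨r, hr, hball⟩ := Euclidean.nhds_basis_closedBall.mem_iff.1 hV
  have hnonneg : {y | 0 ≤ r ^ 2 - Euclidean.dist y z ^ 2} = Euclidean.closedBall z r := by
    ext y
    simp [Euclidean.closedBall, Euclidean.dist, sq_le_sq₀ dist_nonneg hr.le]
  refine ⟨fun y => r ^ 2 - Euclidean.dist y z ^ 2, contDiff_const.sub ?_,
    by simpa [Euclidean.dist] using pow_pos hr 2, hnonneg ▸ Euclidean.isCompact_closedBall,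
    hnonneg ▸ hball⟩
  simp only [Euclidean.dist, dist_eq_norm]
  exact (toEuclidean.contDiff.sub contDiff_const).norm_sq ℝ

variable {E : Type*} [NormedAddCommGroup E] [NormedSpace ℝ E]
  {X : Type*} [TopologicalSpace X] [ChartedSpace E X]

theorem IsSemianalytic.isSubanalytic {A : Set X} (hA : IsSemianalytic 𝓘(ℝ, E) A)
    (hc : IsCompact (closure A)) : IsSubanalytic E A := by
  refine fun _ => ⟨Set.univ, isOpen_univ, trivial, 0, Prod.fst ⁻¹' A,
    hA.preimage contMDiff_fst, ?_, ?_⟩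
  · rw [← Set.prod_univ, closure_prod_eq, closure_univ]
    exact hc.prod (Set.toFinite _).isCompact
  · rw [Set.inter_univ, Set.image_preimage_eq _ Prod.fst_surjective]

/- `R` is the fibre product of `P` and `Q` over `X`. -/
theorem IsSemianalytic.exists_image_fst_eq_inter [T2Space X] {d e : ℕ}
    {P : Set (X × EuclideanSpace ℝ (Fin d))} {Q : Set (X × EuclideanSpace ℝ (Fin e))}
    (hP : IsSemianalytic (𝓘(ℝ, E).prod 𝓘(ℝ, EuclideanSpace ℝ (Fin d))) P)
    (hPc : IsCompact (closure P))
    (hQ : IsSemianalytic (𝓘(ℝ, E).prod 𝓘(ℝ, EuclideanSpace ℝ (Fin e))) Q)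
    (hQc : IsCompact (closure Q)) :
    ∃ R : Set (X × EuclideanSpace ℝ (Fin (d + e))),
      IsSemianalytic (𝓘(ℝ, E).prod 𝓘(ℝ, EuclideanSpace ℝ (Fin (d + e)))) R ∧
      IsCompact (closure R) ∧ Prod.fst '' R = Prod.fst '' P ∩ Prod.fst '' Q := by
  let L : (EuclideanSpace ℝ (Fin d) × EuclideanSpace ℝ (Fin e)) ≃L[ℝ]
    EuclideanSpace ℝ (Fin (d + e)) := ContinuousLinearEquiv.ofFinrankEq (by simp)
  let p (z : X × EuclideanSpace ℝ (Fin (d + e))) := (z.1, (L.symm z.2).1)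
  let q (z : X × EuclideanSpace ℝ (Fin (d + e))) := (z.1, (L.symm z.2).2)
  have hp : ContMDiff (𝓘(ℝ, E).prod 𝓘(ℝ, _)) (𝓘(ℝ, E).prod 𝓘(ℝ, _)) ω p :=
    contMDiff_fst.prodMk (((ContinuousLinearMap.fst ℝ _ _).comp L.symm.toContinuousLinearMap)
      |>.contMDiff.comp contMDiff_snd)
  have hq : ContMDiff (𝓘(ℝ, E).prod 𝓘(ℝ, _)) (𝓘(ℝ, E).prod 𝓘(ℝ, _)) ω q :=
    contMDiff_fst.prodMk (((ContinuousLinearMap.snd ℝ _ _).comp L.symm.toContinuousLinearMap)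
      |>.contMDiff.comp contMDiff_snd)
  refine ⟨p ⁻¹' P ∩ q ⁻¹' Q, (hP.preimage hp).inter (hQ.preimage hq), ?_, ?_⟩
  · have hK := (hPc.prod hQc).image (f := fun z => (z.1.1, L (z.1.2, z.2.2))) (by fun_prop)
    refine hK.of_isClosed_subset isClosed_closure (closure_minimal ?_ hK.isClosed)
    rintro z ⟨hzP, hzQ⟩
    exact ⟨(p z, q z), ⟨subset_closure hzP, subset_closure hzQ⟩, by simp [p, q]⟩
  · ext x
    constructor
    · rintro ⟨z, ⟨hzP, hzQ⟩, rfl⟩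
      exact ⟨⟨_, hzP, rfl⟩, ⟨_, hzQ, rfl⟩⟩
    · rintro ⟨⟨⟨x, a⟩, ha, rfl⟩, ⟨⟨_, b⟩, hb, rfl⟩⟩
      exact ⟨(_, L (a, b)), by simp [p, q, ha, hb], rfl⟩

theorem IsSubanalytic.inter [T2Space X] {A B : Set X} (hA : IsSubanalytic E A)
    (hB : IsSubanalytic E B) : IsSubanalytic E (A ∩ B) := by
  intro x
  obtain ⟨U, hU, hxU, d, P, hP, hPc, hAU⟩ := hA x
  obtain ⟨V, hV, hxV, e, Q, hQ, hQc, hBV⟩ := hB x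
  obtain ⟨R, hR, hRc, hRPQ⟩ := hP.exists_image_fst_eq_inter hPc hQ hQc
  exact ⟨U ∩ V, hU.inter hV, ⟨hxU, hxV⟩, d + e, R, hR, hRc, by
    rw [Set.inter_inter_inter_comm, hAU, hBV, hRPQ]⟩

theorem IsSubanalytic.inter_finset_inf [T2Space X] {U : Opens X}
    (hU : IsSubanalytic E (U : Set X)) {ι : Type*} {f : ι → Opens X} {s : Finset ι}
    (hf : ∀ i ∈ s, IsSubanalytic E (f i : Set X)) :
    IsSubanalytic E ((U ⊓ s.inf f : Opens X) : Set X) := by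
  classical
  induction s using Finset.induction_on with
  | empty => simpa using hU
  | insert i s _ ih =>
    rw [Finset.inf_insert, inf_left_comm]
    exact (hf i (s.mem_insert_self i)).inter
      (ih fun j hj => hf j (Finset.mem_insert_of_mem hj))

variable (E) in
/-- The relatively compact subanalytic subsets of `X`, over which coverings in `X_sa` have finite
subcoverings. -/
structure IsRelCompactSubanalytic (A : Set X) : Prop where
  isSubanalytic : IsSubanalytic E A
  isCompact_closure : IsCompact (closure A)

theorem IsRelCompactSubanalytic.inter [T2Space X] {A B : Set X}
    (hA : IsRelCompactSubanalytic E A) (hB : IsSubanalytic E B) :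
    IsRelCompactSubanalytic E (A ∩ B) :=
  ⟨hA.isSubanalytic.inter hB,
    hA.isCompact_closure.of_isClosed_subset isClosed_closure (closure_mono Set.inter_subset_left)⟩

theorem exists_mem_isRelCompactSubanalytic [FiniteDimensional ℝ E] [T2Space X]
    [IsManifold 𝓘(ℝ, E) ω X] (x : X) :
    ∃ U : Opens X, x ∈ U ∧ IsRelCompactSubanalytic E (U : Set X) := by
  let φ := chartAt E x
  have hx : x ∈ φ.source := mem_chart_source E x
  obtain ⟨g, hg, hgx, hgc, hgφ⟩ := exists_contDiff_pos_isCompact_nonneg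
    (φ.open_target.mem_nhds (φ.map_source hx))
  have hK : IsCompact (φ.symm '' {y | 0 ≤ g y}) :=
    hgc.image_of_continuousOn (φ.continuousOn_symm.mono hgφ)
  have hKφ : φ.symm '' {y | 0 ≤ g y} ⊆ φ.source :=
    Set.image_subset_iff.2 fun y hy => φ.map_target (hgφ hy)
  let U : Opens X := ⟨φ.source ∩ φ ⁻¹' {y | 0 < g y},
    φ.isOpen_inter_preimage (isOpen_lt continuous_const hg.continuous)⟩
  have hUK : closure (U : Set X) ⊆ φ.symm '' {y | 0 ≤ g y} :=
    closure_minimal (fun y hy => ⟨φ y, le_of_lt (show 0 < g (φ y) from hy.2), φ.left_inv hy.1⟩)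
      hK.isClosed
  have hUc : IsCompact (closure (U : Set X)) := hK.of_isClosed_subset isClosed_closure hUK
  have hU : IsSemianalytic 𝓘(ℝ, E) (U : Set X) :=
    isSemianalytic_of_closure_subset φ.open_source (hUK.trans hKφ)
      (hg.contMDiff.comp_contMDiffOn contMDiffOn_chart) fun y hy => and_iff_right hy
  exact ⟨U, ⟨hx, hgx⟩, hU.isSubanalytic hUc, hUc⟩

variable (E X) in
theorem exists_countable_isRelCompactSubanalytic_cover [FiniteDimensional ℝ E] [T2Space X]
    [SecondCountableTopology X] [IsManifold 𝓘(ℝ, E) ω X] :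
    ∃ ℬ : Set (Opens X), ℬ.Countable ∧ (∀ B ∈ ℬ, IsRelCompactSubanalytic E (B : Set X)) ∧
      ∀ x, ∃ B ∈ ℬ, x ∈ B := by
  choose U hxU hU using exists_mem_isRelCompactSubanalytic (E := E) (X := X)
  obtain ⟨T, hT, h⟩ := isOpen_iUnion_countable (fun x => (U x : Set X)) fun x => (U x).isOpen
  refine ⟨U '' T, hT.image _, by rintro _ ⟨x, -, rfl⟩; exact hU x, fun x => ?_⟩
  have hx : x ∈ ⋃ y ∈ T, (U y : Set X) := h ▸ Set.mem_iUnion.2 ⟨x, hxU x⟩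
  simpa using hx

end Subanalytic

section Lattice

variable {E : Type*} [NormedAddCommGroup E] [NormedSpace ℝ E]
  {X : Type*} [TopologicalSpace X] [ChartedSpace E X] {S : Type*} [TopologicalSpace S]

namespace RelOpen

instance : OrderBot (RelOpen E X S) :=
  Subtype.orderBot ⟨∅, Set.finite_empty, by simp, by simp⟩

instance : SemilatticeSup (RelOpen E X S) :=
  Subtype.semilatticeSup fun A B ⟨P, hP, hPsub, hA⟩ ⟨Q, hQ, hQsub, hB⟩ =>
    ⟨P ∪ Q, hP.union hQ, fun p hp => hp.elim (hPsub p) (hQsub p), by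
      rw [Opens.coe_sup, hA, hB, Set.biUnion_union]⟩

instance [T2Space X] : DistribLattice (RelOpen E X S) :=
  Subtype.distribLattice
    (fun A B hA hB => ((⟨A, hA⟩ ⊔ ⟨B, hB⟩ : RelOpen E X S)).2)
    fun A B ⟨P, hP, hPsub, hA⟩ ⟨Q, hQ, hQsub, hB⟩ => by
      refine ⟨Set.image2 (fun p q => (p.1 ⊓ q.1, p.2 ⊓ q.2)) P Q, hP.image2 _ hQ, ?_, ?_⟩
      · rintro _ ⟨p, hp, q, hq, rfl⟩
        exact (hPsub p hp).inter (hQsub q hq)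
      · rw [Opens.coe_inf, hA, hB, Set.biUnion_image2]
        simp only [Set.iUnion₂_inter_iUnion₂, Set.prod_inter_prod, Opens.coe_inf]

theorem mem_finset_sup {ι : Type*} {T : Finset ι} {f : ι → RelOpen E X S} {z : X × S} :
    z ∈ (T.sup f).1 ↔ ∃ i ∈ T, z ∈ (f i).1 := by
  classical
  induction T using Finset.induction_on with
  | empty => exact ⟨fun h => h.elim, fun ⟨_, h, _⟩ => absurd h (Finset.notMem_empty _)⟩
  | insert i T _ ih =>
    rw [Finset.sup_insert, Finset.exists_mem_insert, ← ih]
    rfl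

theorem induction_on {motive : RelOpen E X S → Prop} (W : RelOpen E X S) (bot : motive ⊥)
    (box : ∀ U hU V, motive (box E U hU V)) (sup : ∀ A B, motive A → motive B → motive (A ⊔ B)) :
    motive W := by
  obtain ⟨W, P, hP, hsub, hW⟩ := W
  induction P, hP using Set.Finite.induction_on generalizing W with
  | empty =>
    obtain rfl : W = ⊥ := by simpa using hW
    exact bot
  | @insert p P _ hP ih =>
    obtain ⟨hp, hsub⟩ := Set.forall_mem_insert.1 hsub
    let B : Opens (X × S) :=
      ⟨⋃ p ∈ P, (p.1 : Set X) ×ˢ (p.2 : Set S),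
        isOpen_biUnion fun p _ => p.1.isOpen.prod p.2.isOpen⟩
    obtain rfl : W = (RelOpen.box E p.1 hp p.2).1 ⊔ B :=
      Opens.ext (hW.trans (Set.biUnion_insert ..))
    exact sup _ ⟨B, P, hP, hsub, rfl⟩ (box p.1 hp p.2) (ih B hsub rfl)

theorem exists_box_le {W : RelOpen E X S} {z : X × S} (hz : z ∈ W.1) :
    ∃ U hU V, z ∈ (box E U hU V).1 ∧ box E U hU V ≤ W := by
  induction W using induction_on with
  | bot => exact hz.elim
  | box U hU V => exact ⟨U, hU, V, hz, le_rfl⟩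
  | sup A B hA hB =>
    rcases hz with hz | hz
    · obtain ⟨U, hU, V, hz, hle⟩ := hA hz
      exact ⟨U, hU, V, hz, hle.trans le_sup_left⟩
    · obtain ⟨U, hU, V, hz, hle⟩ := hB hz
      exact ⟨U, hU, V, hz, hle.trans le_sup_right⟩

theorem eventually_prodMk_mem (W : RelOpen E X S) (s : S) :
    ∀ᶠ t in nhds s, ∀ x, (x, s) ∈ W.1 → (x, t) ∈ W.1 := by
  induction W using induction_on with
  | bot => exact .of_forall fun _ _ h => h.elim
  | box U hU V =>
    by_cases hs : s ∈ V
    · filter_upwards [V.isOpen.mem_nhds hs] with t ht x hx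
      exact ⟨hx.1, ht⟩
    · exact .of_forall fun _ _ hx => absurd hx.2 hs
  | sup A B hA hB =>
    filter_upwards [hA, hB] with t htA htB x hx
    exact hx.imp (htA x) (htB x)

/-- The largest open subset `V` of `S` with `U × V ⊆ W`. -/
def slice (W : RelOpen E X S) (U : Set X) : Opens S where
  carrier := {s | ∀ x ∈ U, (x, s) ∈ W.1}
  is_open' := isOpen_iff_eventually.2 fun s hs =>
    (W.eventually_prodMk_mem s).mono fun _ ht x hx => ht x (hs x hx)

end RelOpen

end Lattice

section Covering

section InfOpensAt

variable {X ι : Type*} [TopologicalSpace X]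

open scoped Classical in
/-- The intersection of those members of a finite family of open sets which contain `x`: the
smallest neighbourhood of `x` that the family defines. There are finitely many of these as `x`
varies. -/
noncomputable def infOpensAt (P : Finset ι) (f : ι → Opens X) (x : X) : Opens X :=
  (P.filter (x ∈ f ·)).inf f

theorem mem_infOpensAt (P : Finset ι) (f : ι → Opens X) (x : X) : x ∈ infOpensAt P f x := by
  rw [← SetLike.mem_coe, infOpensAt, Opens.coe_finset_inf, Finset.inf_eq_iInf]
  simp

theorem infOpensAt_le {P : Finset ι} {f : ι → Opens X} {x : X} {i : ι} (hi : i ∈ P)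
    (hx : x ∈ f i) : infOpensAt P f x ≤ f i :=
  Finset.inf_le (by simp [hi, hx])

theorem finite_range_infOpensAt (P : Finset ι) (f : ι → Opens X) :
    (Set.range (infOpensAt P f)).Finite := by
  classical
  refine (P.powerset.image fun Q => Q.inf f).finite_toSet.subset ?_
  rintro _ ⟨x, rfl⟩
  exact Finset.mem_coe.2 (Finset.mem_image_of_mem _ (Finset.mem_powerset.2 (P.filter_subset _)))

end InfOpensAt

section SaCovering

variable {E : Type*} [NormedAddCommGroup E] [NormedSpace ℝ E]
  {X : Type*} [TopologicalSpace X] [ChartedSpace E X] {U : Opens X} {𝒰 : Set (Opens X)}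

theorem isSaCovering_of_finite (hfin : 𝒰.Finite)
    (h𝒰 : ∀ U' ∈ 𝒰, IsSubanalytic E (U' : Set X) ∧ U' ≤ U) (hU : ∀ x ∈ U, ∃ U' ∈ 𝒰, x ∈ U') :
    IsSaCovering E U 𝒰 := by
  refine ⟨h𝒰, fun K _ => ⟨𝒰, subset_rfl, hfin, ?_⟩⟩
  congr 1
  exact Set.Subset.antisymm (Set.iUnion₂_subset fun U' hU' => (h𝒰 U' hU').2)
    fun x hx => by simpa using hU x hx

theorem isSaCovering_image_inf [T2Space X] (hU : IsSubanalytic E (U : Set X)) {ℬ : Set (Opens X)}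
    (hℬ : ∀ B ∈ ℬ, IsSubanalytic E (B : Set X)) (hcover : ∀ x, ∃ B ∈ ℬ, x ∈ B) :
    IsSaCovering E U ((U ⊓ ·) '' ℬ) := by
  refine ⟨?_, fun K hK => ?_⟩
  · rintro _ ⟨B, hB, rfl⟩
    exact ⟨hU.inter (hℬ B hB), inf_le_left⟩
  · obtain ⟨T, hTℬ, hT, hKT⟩ := hK.elim_finite_subcover_image (b := ℬ)
      (c := fun B : Opens X => (B : Set X)) (fun B _ => B.isOpen) fun x _ => by simpa using hcover x
    refine ⟨(U ⊓ ·) '' T, Set.image_mono hTℬ, hT.image _, ?_⟩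
    rw [Set.biUnion_image]
    simp only [Opens.coe_inf]
    rw [← Set.inter_iUnion₂, Set.inter_left_comm, Set.inter_eq_left.2 hKT, Set.inter_comm]

theorem IsSaCovering.exists_finset (h𝒰 : IsSaCovering E U 𝒰) {K : Set X} (hK : IsCompact K) :
    ∃ T : Finset (Opens X), ↑T ⊆ 𝒰 ∧ ∀ x ∈ K, x ∈ U → ∃ U' ∈ T, x ∈ U' := by
  obtain ⟨T, hT𝒰, hT, h⟩ := h𝒰.2 K hK
  refine ⟨hT.toFinset, by simpa using hT𝒰, fun x hxK hxU => ?_⟩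
  have hx : x ∈ K ∩ ⋃ U' ∈ T, (U' : Set X) := h ▸ ⟨hxK, hxU⟩
  simpa using hx.2

end SaCovering

variable {E : Type*} [NormedAddCommGroup E] [NormedSpace ℝ E]
  {X : Type*} [TopologicalSpace X] [ChartedSpace E X] {S : Type*} [TopologicalSpace S]
  {A W : RelOpen E X S} {T : Set (RelOpen E X S)}

theorem exists_finset_forall_prod_subset (T : Finset (RelOpen E X S)) :
    ∃ P : Finset (Opens X × Opens S),
      (∀ p ∈ P, IsSubanalytic E (p.1 : Set X) ∧
        ∃ B ∈ T, (p.1 : Set X) ×ˢ (p.2 : Set S) ⊆ (B.1 : Set (X × S))) ∧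
      ∀ B ∈ T, ∀ z ∈ B.1, ∃ p ∈ P, z.1 ∈ p.1 ∧ z.2 ∈ p.2 := by
  classical
  choose P hP hsub hB using fun B : RelOpen E X S => B.2
  refine ⟨T.biUnion fun B => (hP B).toFinset, fun p hp => ?_, fun B hBT z hz => ?_⟩
  · obtain ⟨B, hBT, hpB⟩ := Finset.mem_biUnion.1 hp
    rw [Set.Finite.mem_toFinset] at hpB
    exact ⟨hsub B p hpB, B, hBT, hB B ▸ Set.subset_biUnion_of_mem
      (u := fun p : Opens X × Opens S => (p.1 : Set X) ×ˢ (p.2 : Set S)) hpB⟩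
  · rw [← SetLike.mem_coe, hB B] at hz
    obtain ⟨p, hp, hzp⟩ := Set.mem_iUnion₂.1 hz
    exact ⟨p, Finset.mem_biUnion.2 ⟨B, hBT, (hP B).mem_toFinset.2 hp⟩, hzp.1, hzp.2⟩

theorem isRelCovering_of_finset [T2Space X] {T : Finset (RelOpen E X S)} (hT : ∀ B ∈ T, B ≤ W)
    (hW : W ≤ T.sup id) : IsRelCovering W (T : Set (RelOpen E X S)) := by
  refine ⟨hT, fun U V hU hUV => ?_⟩
  classical
  obtain ⟨P, hP, hTP⟩ := exists_finset_forall_prod_subset T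
  have hUVP (x) (hx : x ∈ U) (s) (hs : s ∈ V) : ∃ p ∈ P, x ∈ p.1 ∧ s ∈ p.2 := by
    obtain ⟨B, hB, hz⟩ := RelOpen.mem_finset_sup.1 (hW (hUV (Set.mk_mem_prod hx hs)))
    exact hTP B hB (x, s) hz
  refine ⟨(fun x => U ⊓ infOpensAt P Prod.fst x) '' U,
    (fun s => V ⊓ infOpensAt P Prod.snd s) '' V, isSaCovering_of_finite ?_ ?_ ?_, ?_, ?_⟩
  · rw [← Function.comp_def, Set.image_comp]
    exact ((finite_range_infOpensAt P _).subset (Set.image_subset_range ..)).image _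
  · rintro _ ⟨x, -, rfl⟩
    exact ⟨hU.inter_finset_inf fun p hp => (hP p (Finset.mem_of_mem_filter p hp)).1, inf_le_left⟩
  · exact fun x hx => ⟨_, Set.mem_image_of_mem _ hx, hx, mem_infOpensAt ..⟩
  · refine le_antisymm (sSup_le ?_) fun s hs => Opens.mem_sSup.2
      ⟨_, Set.mem_image_of_mem _ hs, hs, mem_infOpensAt ..⟩
    rintro _ ⟨s, -, rfl⟩
    exact inf_le_left
  · rintro _ ⟨x, hx, rfl⟩ _ ⟨s, hs, rfl⟩
    obtain ⟨p, hp, hxp, hsp⟩ := hUVP x hx s hs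
    obtain ⟨-, B, hB, hpB⟩ := hP p hp
    exact ⟨B, hB, (Set.prod_mono (inf_le_right.trans (infOpensAt_le hp hxp))
      (inf_le_right.trans (infOpensAt_le hp hsp))).trans hpB⟩

theorem IsRelCovering.exists_mem (hT : IsRelCovering W T) {z : X × S} (hz : z ∈ W.1) :
    ∃ A ∈ T, z ∈ A.1 := by
  obtain ⟨U, hU, V, hzUV, hUV⟩ := RelOpen.exists_box_le hz
  obtain ⟨𝒰, 𝒱, h𝒰, h𝒱, h⟩ := hT.2 U V hU hUV
  obtain ⟨𝒰₀, h𝒰₀, hx⟩ := h𝒰.exists_finset isCompact_singleton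
  obtain ⟨U', hU', hzU⟩ := hx z.1 rfl hzUV.1
  obtain ⟨V', hV', hzV⟩ := Opens.mem_sSup.1 (h𝒱 ▸ hzUV.2)
  obtain ⟨A, hA, hA'⟩ := h U' (h𝒰₀ hU') V' hV'
  exact ⟨A, hA, hA' ⟨hzU, hzV⟩⟩

theorem IsRelCovering.image_inf [T2Space X] (hT : IsRelCovering W T) (hA : A ≤ W) :
    IsRelCovering A ((· ⊓ A) '' T) := by
  refine ⟨by rintro _ ⟨B, -, rfl⟩; exact inf_le_right, fun U V hU hUV => ?_⟩
  obtain ⟨𝒰, 𝒱, h𝒰, rfl, h⟩ := hT.2 U V hU (hUV.trans hA)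
  refine ⟨𝒰, 𝒱, h𝒰, rfl, fun U' hU' V' hV' => ?_⟩
  obtain ⟨B, hB, hUVB⟩ := h U' hU' V' hV'
  exact ⟨B ⊓ A, Set.mem_image_of_mem _ hB,
    Set.subset_inter hUVB <| (Set.prod_mono (h𝒰.1 U' hU').2
      (show V' ≤ sSup 𝒱 from le_sSup hV')).trans hUV⟩

end Covering

section WC

variable {E : Type*} [NormedAddCommGroup E] [NormedSpace ℝ E]
  {X : Type*} [TopologicalSpace X] [ChartedSpace E X] {S : Type*} [TopologicalSpace S]
  {A A' B W W' : RelOpen E X S} {T : Set (RelOpen E X S)}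

theorem IsWC.le (h : IsWC A W) : A ≤ W := h.1

theorem IsWC.exists_finset (h : IsWC A W) (hT : IsRelCovering W T) :
    ∃ T₀ : Finset (RelOpen E X S), ↑T₀ ⊆ T ∧ A ≤ T₀.sup id := by
  classical
  obtain ⟨T', hT', hA, h⟩ := h.2 T hT
  choose! f hfT hf using h
  refine ⟨hT'.toFinset.image f, ?_, fun z hz => ?_⟩
  · rw [Finset.coe_image, hT'.coe_toFinset]
    exact Set.image_subset_iff.2 hfT
  · obtain ⟨B, hB, hzB⟩ := hA.exists_mem hz
    exact RelOpen.mem_finset_sup.2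
      ⟨f B, Finset.mem_image_of_mem f (hT'.mem_toFinset.2 hB), hf B hB hzB⟩

theorem isWC_iff [T2Space X] : IsWC A W ↔ A ≤ W ∧ ∀ T, IsRelCovering W T →
    ∃ T₀ : Finset (RelOpen E X S), ↑T₀ ⊆ T ∧ A ≤ T₀.sup id := by
  classical
  refine ⟨fun h => ⟨h.1, fun T => h.exists_finset⟩, fun ⟨hAW, h⟩ => ⟨hAW, fun T hT => ?_⟩⟩
  obtain ⟨T₀, hT₀, hA⟩ := h T hT
  refine ⟨T₀.image (· ⊓ A), Finset.finite_toSet _, isRelCovering_of_finset ?_ ?_, ?_⟩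
  · exact Finset.forall_mem_image.2 fun _ _ => inf_le_right
  · rw [Finset.sup_image, Function.id_comp]
    exact (Finset.sup_inf_distrib_right T₀ id A).symm ▸ le_inf hA le_rfl
  · exact Finset.forall_mem_image.2 fun B hB => ⟨B, hT₀ hB, inf_le_left⟩

theorem IsWC.mono [T2Space X] (h : IsWC A W) (hA : A' ≤ A) (hW : W ≤ W') : IsWC A' W' := by
  classical
  refine isWC_iff.2 ⟨hA.trans (h.1.trans hW), fun T hT => ?_⟩
  obtain ⟨T₀, hT₀, hAT₀⟩ := h.exists_finset (hT.image_inf hW)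
  obtain ⟨T₁, hT₁, rfl⟩ := Finset.subset_set_image_iff.1 hT₀
  refine ⟨T₁, hT₁, hA.trans (hAT₀.trans ?_)⟩
  rw [Finset.sup_image]
  exact Finset.sup_mono_fun fun B _ => inf_le_left

theorem isWC_bot [T2Space X] (W : RelOpen E X S) : IsWC ⊥ W :=
  isWC_iff.2 ⟨bot_le, fun _ _ => ⟨∅, by simp, bot_le⟩⟩

theorem IsWC.sup [T2Space X] (hA : IsWC A W) (hB : IsWC B W) : IsWC (A ⊔ B) W := by
  classical
  refine isWC_iff.2 ⟨sup_le hA.1 hB.1, fun T hT => ?_⟩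
  obtain ⟨T₁, hT₁, hAT₁⟩ := hA.exists_finset hT
  obtain ⟨T₂, hT₂, hBT₂⟩ := hB.exists_finset hT
  exact ⟨T₁ ∪ T₂, by simp [hT₁, hT₂], (sup_le_sup hAT₁ hBT₂).trans_eq Finset.sup_union.symm⟩

theorem isWC_finset_sup [T2Space X] {ι : Type*} {s : Finset ι} {f : ι → RelOpen E X S}
    (h : ∀ i ∈ s, IsWC (f i) W) : IsWC (s.sup f) W :=
  Finset.sup_induction (p := (IsWC · W)) (isWC_bot W) (fun _ hA _ hB => hA.sup hB) h

end WC

section Topology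

variable {E : Type*} [NormedAddCommGroup E] [NormedSpace ℝ E]
  {X : Type*} [TopologicalSpace X] [ChartedSpace E X] {S : Type*} [TopologicalSpace S]
  {A B C W W' : RelOpen E X S} {T : Set (RelOpen E X S)}

/-- `B` is a product `U × V`, with `U` relatively compact and `V` contained in a compact set `K`
such that `U × K ⊆ W`. These are the basic examples of objects weakly quasi-compact in `W`; note
that the closure of `U` need not be involved in `W`. -/
inductive IsCompactBox (W : RelOpen E X S) : RelOpen E X S → Prop
  | intro {U : Opens X} (hU : IsRelCompactSubanalytic E (U : Set X)) {V : Opens S} {K : Set S}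
    (hK : IsCompact K) (hVK : (V : Set S) ⊆ K) (hUK : ∀ x ∈ U, ∀ s ∈ K, (x, s) ∈ W.1) :
    IsCompactBox W (RelOpen.box E U hU.isSubanalytic V)

theorem IsRelCovering.exists_finset_prod_subset {U : Opens X}
    (hT : IsRelCovering W T) (hU : IsRelCompactSubanalytic E (U : Set X)) {K : Set S}
    (hK : IsCompact K) (hUK : ∀ x ∈ U, ∀ s ∈ K, (x, s) ∈ W.1) :
    ∃ T₀ : Finset (RelOpen E X S), ↑T₀ ⊆ T ∧ ∀ x ∈ U, ∀ s ∈ K, (x, s) ∈ (T₀.sup id).1 := by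
  classical
  refine hK.induction_on (p := fun L => ∃ T₀ : Finset (RelOpen E X S), ↑T₀ ⊆ T ∧
    ∀ x ∈ U, ∀ s ∈ L, (x, s) ∈ (T₀.sup id).1) ⟨∅, by simp, by simp⟩ ?_ ?_ ?_
  · exact fun L L' hL ⟨T₀, hT₀, h⟩ => ⟨T₀, hT₀, fun x hx s hs => h x hx s (hL hs)⟩
  · rintro L L' ⟨T₁, hT₁, h₁⟩ ⟨T₂, hT₂, h₂⟩
    refine ⟨T₁ ∪ T₂, by simp [hT₁, hT₂], fun x hx s hs => ?_⟩
    rw [Finset.sup_union]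
    exact hs.imp (h₁ x hx s) (h₂ x hx s)
  · intro s hs
    obtain ⟨𝒰, 𝒱, h𝒰, h𝒱, h⟩ := hT.2 U (W.slice U) hU.isSubanalytic
      fun z hz => hz.2 z.1 hz.1
    have hsW : s ∈ W.slice U := fun x hx => hUK x hx s hs
    obtain ⟨V, hV, hsV⟩ := Opens.mem_sSup.1 (h𝒱 ▸ hsW)
    obtain ⟨𝒰₀, h𝒰₀, hU𝒰₀⟩ := h𝒰.exists_finset hU.isCompact_closure
    choose! f hfT hf using fun U' hU' => h U' hU' V hV
    refine ⟨V, mem_nhdsWithin_of_mem_nhds (V.isOpen.mem_nhds hsV), 𝒰₀.image f, ?_,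
      fun x hx t ht => ?_⟩
    · rw [Finset.coe_image]
      exact Set.image_subset_iff.2 fun U' hU' => hfT U' (h𝒰₀ hU')
    · obtain ⟨U', hU', hxU'⟩ := hU𝒰₀ x (subset_closure hx) hx
      exact RelOpen.mem_finset_sup.2
        ⟨f U', Finset.mem_image_of_mem f hU', hf U' (h𝒰₀ hU') ⟨hxU', ht⟩⟩

theorem IsCompactBox.isWC [T2Space X] (h : IsCompactBox W B) : IsWC B W := by
  obtain ⟨hU, hK, hVK, hUK⟩ := h
  refine isWC_iff.2 ⟨fun z hz => hUK z.1 hz.1 z.2 (hVK hz.2), fun T hT => ?_⟩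
  obtain ⟨T₀, hT₀, h⟩ := hT.exists_finset_prod_subset hU hK hUK
  exact ⟨T₀, hT₀, fun z hz => h z.1 hz.1 z.2 (hVK hz.2)⟩

theorem isRelCovering_isCompactBox [FiniteDimensional ℝ E] [T2Space X] [IsManifold 𝓘(ℝ, E) ω X]
    [LocallyCompactSpace S] (W : RelOpen E X S) : IsRelCovering W {B | IsCompactBox W B} := by
  refine ⟨fun B ⟨hU, _, hVK, hUK⟩ z hz => hUK z.1 hz.1 z.2 (hVK hz.2), fun U V hU hUV => ?_⟩
  refine ⟨(U ⊓ ·) '' {B | IsRelCompactSubanalytic E (B : Set X)},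
    {V' | ∃ K, IsCompact K ∧ (V' : Set S) ⊆ K ∧ K ⊆ V},
    isSaCovering_image_inf hU (fun B hB => hB.isSubanalytic) fun x => ?_, ?_, ?_⟩
  · exact (exists_mem_isRelCompactSubanalytic x).imp fun B hB => hB.symm
  · refine le_antisymm (sSup_le fun V' ⟨K, _, hV'K, hKV⟩ => hV'K.trans hKV) fun s hs => ?_
    obtain ⟨K, hK, hsK, hKV⟩ := exists_compact_subset V.isOpen hs
    exact Opens.mem_sSup.2 ⟨⟨interior K, isOpen_interior⟩, ⟨K, hK, interior_subset, hKV⟩, hsK⟩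
  · rintro _ ⟨B, hB, rfl⟩ V' ⟨K, hK, hV'K, hKV⟩
    have hUB : IsRelCompactSubanalytic E ((U ⊓ B : Opens X) : Set X) := by
      rw [inf_comm]
      exact hB.inter hU
    exact ⟨_, ⟨hUB, hK, hV'K, fun x hx s hs => hUV ⟨hx.1, hKV hs⟩⟩, subset_rfl⟩

section Manifold

variable [FiniteDimensional ℝ E] [T2Space X] [IsManifold 𝓘(ℝ, E) ω X] [LocallyCompactSpace S]

@[elab_as_elim]
theorem IsWC.induction_on {motive : ∀ B : RelOpen E X S, IsWC B W → Prop} (h : IsWC A W)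
    (bot : motive ⊥ (isWC_bot W))
    (mono : ∀ B C hC, (hBC : B ≤ C) → motive C hC → motive B (hC.mono hBC le_rfl))
    (sup : ∀ B C hB hC, motive B hB → motive C hC → motive (B ⊔ C) (hB.sup hC))
    (box : ∀ B, (hB : IsCompactBox W B) → motive B hB.isWC) : motive A h := by
  obtain ⟨T₀, hT₀, hA⟩ := h.exists_finset (isRelCovering_isCompactBox W)
  obtain ⟨hsup, hm⟩ : ∃ h, motive (T₀.sup id) h :=
    Finset.sup_induction (p := fun B => ∃ h, motive B h) ⟨_, bot⟩
      (fun B ⟨hB, hmB⟩ C ⟨hC, hmC⟩ => ⟨_, sup B C hB hC hmB hmC⟩)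
      fun B hB => ⟨_, box B (hT₀ hB)⟩
  exact mono _ _ hsup hA hm

theorem IsWC.inf [T2Space S] (hA : IsWC A W) (hB : IsWC B W') : IsWC (A ⊓ B) (W ⊓ W') := by
  induction hA using IsWC.induction_on with
  | bot => exact (isWC_bot _).mono inf_le_left le_rfl
  | mono C D _ hCD hD => exact hD.mono (inf_le_inf_right B hCD) le_rfl
  | sup C D _ _ hC hD => exact inf_sup_right C D B ▸ hC.sup hD
  | box A hA =>
    induction hB using IsWC.induction_on with
    | bot => exact (isWC_bot _).mono inf_le_right le_rfl
    | mono C D _ hCD hD => exact hD.mono (inf_le_inf_left A hCD) le_rfl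
    | sup C D _ _ hC hD => exact inf_sup_left A C D ▸ hC.sup hD
    | box B hB =>
      obtain @⟨U, hU, V, K, hK, hVK, hUK⟩ := hA
      obtain @⟨U', hU', V', K', hK', hVK', hUK'⟩ := hB
      have hUU' : IsRelCompactSubanalytic E ((U ⊓ U' : Opens X) : Set X) :=
        hU.inter hU'.isSubanalytic
      have hbox : IsCompactBox (W ⊓ W') (RelOpen.box E (U ⊓ U') hUU'.isSubanalytic (V ⊓ V')) :=
        .intro hUU' (hK.inter hK') (Set.inter_subset_inter hVK hVK') fun x hx s hs =>
          ⟨hUK x hx.1 s hs.1, hUK' x hx.2 s hs.2⟩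
      exact hbox.isWC.mono (fun z hz => ⟨⟨hz.1.1, hz.2.1⟩, hz.1.2, hz.2.2⟩) le_rfl

end Manifold

theorem exists_isWC_eventually_mem [T2Space X] [LocallyCompactSpace S] {U : Opens X}
    (hU : IsRelCompactSubanalytic E (U : Set X)) (s : S) (W : RelOpen E X S) :
    ∃ A, IsWC A W ∧ ∀ᶠ t in nhds s, ∀ x ∈ U, (x, s) ∈ W.1 → (x, t) ∈ A.1 := by
  induction W using RelOpen.induction_on with
  | bot => exact ⟨⊥, isWC_bot ⊥, .of_forall fun _ _ _ h => h.elim⟩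
  | box U₀ hU₀ V =>
    by_cases hs : s ∈ V
    · obtain ⟨K, hK, hsK, hKV⟩ := exists_compact_subset V.isOpen hs
      have hUU₀ : IsRelCompactSubanalytic E ((U ⊓ U₀ : Opens X) : Set X) := hU.inter hU₀
      refine ⟨RelOpen.box E (U ⊓ U₀) hUU₀.isSubanalytic ⟨interior K, isOpen_interior⟩,
        IsCompactBox.isWC (.intro hUU₀ hK interior_subset fun x hx t ht => ⟨hx.2, hKV ht⟩), ?_⟩
      filter_upwards [isOpen_interior.mem_nhds hsK] with t ht x hx hxs
      exact ⟨⟨hx, hxs.1⟩, ht⟩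
    · exact ⟨⊥, isWC_bot _, .of_forall fun _ _ _ h => absurd h.2 hs⟩
  | sup B C hB hC =>
    obtain ⟨B', hB', hsB⟩ := hB
    obtain ⟨C', hC', hsC⟩ := hC
    refine ⟨B' ⊔ C', (hB'.mono le_rfl le_sup_left).sup (hC'.mono le_rfl le_sup_right), ?_⟩
    filter_upwards [hsB, hsC] with t htB htC x hx hxs
    exact hxs.imp (htB x hx) (htC x hx)

theorem exists_isWC_prod_subset_sup [T2Space X] [LocallyCompactSpace S] {U : Opens X}
    (hU : IsRelCompactSubanalytic E (U : Set X)) {K : Set S} (hK : IsCompact K)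
    (hUK : ∀ x ∈ U, ∀ s ∈ K, (x, s) ∈ (B ⊔ C).1) :
    ∃ B' C', IsWC B' B ∧ IsWC C' C ∧ ∀ x ∈ U, ∀ s ∈ K, (x, s) ∈ (B' ⊔ C').1 := by
  refine hK.induction_on (p := fun L => ∃ B' C', IsWC B' B ∧ IsWC C' C ∧
    ∀ x ∈ U, ∀ s ∈ L, (x, s) ∈ (B' ⊔ C').1)
    ⟨⊥, ⊥, isWC_bot B, isWC_bot C, by simp⟩ ?_ ?_ fun s hs => ?_
  · exact fun L L' hL ⟨B', C', hB', hC', h⟩ => ⟨B', C', hB', hC', fun x hx s hs => h x hx s (hL hs)⟩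
  · rintro L L' ⟨B₁, C₁, hB₁, hC₁, h₁⟩ ⟨B₂, C₂, hB₂, hC₂, h₂⟩
    refine ⟨B₁ ⊔ B₂, C₁ ⊔ C₂, hB₁.sup hB₂, hC₁.sup hC₂, fun x hx s hs => ?_⟩
    rw [sup_sup_sup_comm]
    exact hs.imp (h₁ x hx s) (h₂ x hx s)
  · obtain ⟨B', hB', hsB⟩ := exists_isWC_eventually_mem hU s B
    obtain ⟨C', hC', hsC⟩ := exists_isWC_eventually_mem hU s C
    refine ⟨_, mem_nhdsWithin_of_mem_nhds (hsB.and hsC), B', C', hB', hC', fun x hx t ht => ?_⟩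
    exact (hUK x hx s hs).imp (ht.1 x hx) (ht.2 x hx)

section Manifold

variable [FiniteDimensional ℝ E] [T2Space X] [IsManifold 𝓘(ℝ, E) ω X] [LocallyCompactSpace S]

theorem IsWC.exists_isWC_sup (h : IsWC A (B ⊔ C)) :
    ∃ B' C', IsWC B' B ∧ IsWC C' C ∧ IsWC A (B' ⊔ C') := by
  induction h using IsWC.induction_on with
  | bot => exact ⟨⊥, ⊥, isWC_bot B, isWC_bot C, isWC_bot _⟩
  | mono A₁ A₂ _ hA h =>
    obtain ⟨B', C', hB', hC', h⟩ := h
    exact ⟨B', C', hB', hC', h.mono hA le_rfl⟩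
  | sup A₁ A₂ _ _ h₁ h₂ =>
    obtain ⟨B₁, C₁, hB₁, hC₁, h₁⟩ := h₁
    obtain ⟨B₂, C₂, hB₂, hC₂, h₂⟩ := h₂
    exact ⟨B₁ ⊔ B₂, C₁ ⊔ C₂, hB₁.sup hB₂, hC₁.sup hC₂,
      (h₁.mono le_rfl (sup_le_sup le_sup_left le_sup_left)).sup
        (h₂.mono le_rfl (sup_le_sup le_sup_right le_sup_right))⟩
  | box A hA =>
    obtain ⟨hU, hK, hVK, hUK⟩ := hA
    obtain ⟨B', C', hB', hC', h⟩ := exists_isWC_prod_subset_sup hU hK hUK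
    exact ⟨B', C', hB', hC', (IsCompactBox.intro hU hK hVK h).isWC⟩

theorem IsWC.exists_between (h : IsWC A W) : ∃ B, IsWC A B ∧ IsWC B W := by
  obtain ⟨B, C, hB, hC, hA⟩ := (h.mono le_rfl le_sup_left : IsWC A (W ⊔ W)).exists_isWC_sup
  exact ⟨B ⊔ C, hA, hB.sup hC⟩

theorem IsWC.exists_isWC_finset_sup {ι : Type*} {T : Finset ι} {f : ι → RelOpen E X S}
    (h : IsWC A (T.sup f)) : ∃ g : ι → RelOpen E X S, (∀ i, IsWC (g i) (f i)) ∧ A ≤ T.sup g := by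
  classical
  induction T using Finset.induction_on generalizing A with
  | empty => exact ⟨fun _ => ⊥, fun _ => isWC_bot _, h.1⟩
  | insert i T hi ih =>
    rw [Finset.sup_insert] at h
    obtain ⟨B, C, hB, hC, hA⟩ := h.exists_isWC_sup
    obtain ⟨g, hg, hCg⟩ := ih hC
    refine ⟨Function.update g i B, fun j => ?_, ?_⟩
    · obtain rfl | hj := eq_or_ne j i
      · simpa using hB
      · simpa [hj] using hg j
    · rw [Finset.sup_insert, Function.update_self,
        Finset.sup_congr rfl fun j hj => Function.update_of_ne (ne_of_mem_of_not_mem hj hi) B g]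
      exact hA.1.trans (sup_le_sup_left hCg B)

end Manifold

end Topology

section Sieves

variable {E : Type w} [NormedAddCommGroup E] [NormedSpace ℝ E] {X : Type u} [TopologicalSpace X]
  [ChartedSpace E X] {S : Type v} [TopologicalSpace S] {A W : RelOpen E X S}

theorem mem_relTopology_of_isRelCovering {R : Sieve W} {T : Set (RelOpen E X S)}
    (hT : IsRelCovering W T) (hR : ∀ B ∈ T, ∃ f : B ⟶ W, R f) : R ∈ relTopology E X S W := by
  have hgen : Sieve.generate (fun B (_ : B ⟶ W) => B ∈ T) ∈ relTopology E X S W := by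
    refine Precoverage.generate_mem_toGrothendieck (J := relPrecoverage E X S) ?_
    change IsRelCovering W {B | ∃ _ : B ⟶ W, B ∈ T}
    convert hT using 1
    exact Set.ext fun B => ⟨fun ⟨_, hB⟩ => hB, fun hB => ⟨homOfLE (hT.1 B hB), hB⟩⟩
  refine GrothendieckTopology.superset_covering _ ((Sieve.generate_le_iff _ _).2 ?_) hgen
  intro B f hB
  obtain ⟨g, hg⟩ := hR B hB
  exact Subsingleton.elim g f ▸ hg

variable [FiniteDimensional ℝ E] [T2Space X] [IsManifold 𝓘(ℝ, E) ω X] [LocallyCompactSpace S]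

/- The generating coverings are not visibly stable under composition, hence the induction on the
generation of the topology: its transitivity step uses that `A ⋐ W` can be interpolated. -/
theorem exists_finset_of_mem_relTopology {R : Sieve W} (hR : R ∈ relTopology E X S W)
    (hA : IsWC A W) :
    ∃ T : Finset (RelOpen E X S), (∀ B ∈ T, ∃ f : B ⟶ W, R f) ∧ A ≤ T.sup id := by
  classical
  induction hR generalizing A with
  | of W R hR =>
    obtain ⟨T, hT, hAT⟩ := hA.exists_finset hR
    exact ⟨T, fun B hB => (hT hB).imp fun f hf => Sieve.le_generate R _ _ hf, hAT⟩
  | top W =>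
    exact ⟨{W}, fun B hB => ⟨eqToHom (Finset.mem_singleton.1 hB), trivial⟩, by simpa using hA.1⟩
  | pullback W R _ W' f ih =>
    obtain ⟨T, hT, hAT⟩ := ih (hA.mono le_rfl (leOfHom f))
    refine ⟨T.image (· ⊓ W'), Finset.forall_mem_image.2 fun B hB => ?_, ?_⟩
    · obtain ⟨g, hg⟩ := hT B hB
      exact ⟨homOfLE inf_le_right, R.downward_closed hg (homOfLE inf_le_left)⟩
    · rw [Finset.sup_image, Function.id_comp]
      exact (Finset.sup_inf_distrib_right T id W').symm ▸ le_inf hAT hA.1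
  | transitive W R R' _ _ ih ih' =>
    obtain ⟨D, hAD, hDW⟩ := hA.exists_between
    obtain ⟨T, hT, hDT⟩ := ih hDW
    obtain ⟨g, hg, hAg⟩ := (hAD.mono le_rfl hDT).exists_isWC_finset_sup
    choose f hf using hT
    choose! T' hT' hgT' using fun B hB => ih' (hf B hB) (hg B)
    refine ⟨T.biUnion T', fun C hC => ?_, hAg.trans ?_⟩
    · obtain ⟨B, hB, hCB⟩ := Finset.mem_biUnion.1 hC
      obtain ⟨e, he⟩ := hT' B hB C hCB
      exact ⟨_, he⟩
    · rw [Finset.sup_biUnion]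
      exact Finset.sup_mono_fun hgT'

end Sieves

section Exhaustion

variable {E : Type*} [NormedAddCommGroup E] [NormedSpace ℝ E] {X : Type*} [TopologicalSpace X]
  [ChartedSpace E X] {S : Type*} [TopologicalSpace S]

theorem exists_countable_opens_subset_compact [LocallyCompactSpace S] [SecondCountableTopology S]
    (V : Opens S) : ∃ 𝒱 : Set (Opens S), 𝒱.Countable ∧
      (∀ V' ∈ 𝒱, ∃ K, IsCompact K ∧ (V' : Set S) ⊆ K ∧ K ⊆ V) ∧ sSup 𝒱 = V := by
  obtain ⟨𝒱, h𝒱, hcount, hcover⟩ := isOpen_biUnion_countable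
    {V' : Opens S | ∃ K, IsCompact K ∧ (V' : Set S) ⊆ K ∧ K ⊆ V} (fun V' => (V' : Set S))
    fun V' _ => V'.isOpen
  refine ⟨𝒱, hcount, h𝒱, le_antisymm (sSup_le fun V' hV' => ?_) fun s hs => ?_⟩
  · obtain ⟨K, -, hV'K, hKV⟩ := h𝒱 hV'
    exact hV'K.trans hKV
  · obtain ⟨K, hK, hsK, hKV⟩ := exists_compact_subset V.isOpen hs
    rw [← SetLike.mem_coe, Opens.coe_sSup, hcover]
    exact Set.mem_biUnion (x := (⟨interior K, isOpen_interior⟩ : Opens S))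
      ⟨K, hK, interior_subset, hKV⟩ hsK

theorem IsRelCovering.exists_countable_cofinal_isWC [T2Space X] {W : RelOpen E X S}
    {T : Set (RelOpen E X S)} (hT : IsRelCovering W T) (hcount : T.Countable)
    (hTW : ∀ B ∈ T, IsWC B W) :
    ∃ 𝒜 : Set (RelOpen E X S), 𝒜.Countable ∧ (∀ A ∈ 𝒜, IsWC A W) ∧
      ∀ A, IsWC A W → ∃ B ∈ 𝒜, A ≤ B := by
  classical
  have := hcount.to_subtype
  refine ⟨Set.range fun T₀ : Finset T => T₀.sup Subtype.val, Set.countable_range _, ?_,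
    fun A hA => ?_⟩
  · rintro _ ⟨T₀, rfl⟩
    exact isWC_finset_sup fun B _ => hTW B B.2
  · obtain ⟨T₀, hT₀, hAT₀⟩ := hA.exists_finset hT
    refine ⟨_, ⟨T₀.subtype (· ∈ T), rfl⟩, hAT₀.trans (Finset.sup_le fun B hB => ?_)⟩
    exact Finset.le_sup (f := Subtype.val) (b := (⟨B, hT₀ hB⟩ : T)) (Finset.mem_subtype.2 hB)

variable [FiniteDimensional ℝ E] [T2Space X] [IsManifold 𝓘(ℝ, E) ω X] [LocallyCompactSpace S]

theorem isRelCovering_of_cofinal_isWC {W : RelOpen E X S} {T : Set (RelOpen E X S)}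
    (hTW : ∀ B ∈ T, B ≤ W) (hT : ∀ A, IsWC A W → ∃ B ∈ T, A ≤ B) : IsRelCovering W T := by
  refine ⟨hTW, fun U V hU hUV => ?_⟩
  obtain ⟨𝒰, 𝒱, h𝒰, h𝒱, h⟩ := (isRelCovering_isCompactBox W).2 U V hU hUV
  refine ⟨𝒰, 𝒱, h𝒰, h𝒱, fun U' hU' V' hV' => ?_⟩
  obtain ⟨A, hA, hUA⟩ := h U' hU' V' hV'
  obtain ⟨B, hB, hAB⟩ := hT A hA.isWC
  exact ⟨B, hB, hUA.trans hAB⟩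

variable [SecondCountableTopology X] [SecondCountableTopology S]

theorem exists_countable_isRelCovering_box {U : Opens X} (hU : IsSubanalytic E (U : Set X))
    (V : Opens S) : ∃ T : Set (RelOpen E X S), T.Countable ∧
      (∀ B ∈ T, IsWC B (RelOpen.box E U hU V)) ∧ IsRelCovering (RelOpen.box E U hU V) T := by
  obtain ⟨ℬ, hℬc, hℬ, hcover⟩ := exists_countable_isRelCompactSubanalytic_cover E X
  obtain ⟨𝒱, h𝒱c, h𝒱, rfl⟩ := exists_countable_opens_subset_compact V
  have := hℬc.to_subtype
  have := h𝒱c.to_subtype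
  have hUB (B : ℬ) : IsRelCompactSubanalytic E ((B ⊓ U : Opens X) : Set X) := (hℬ B B.2).inter hU
  let T : ℬ × 𝒱 → RelOpen E X S := fun p => RelOpen.box E (p.1 ⊓ U) (hUB p.1).isSubanalytic p.2
  have hT (p) : IsWC (T p) (RelOpen.box E U hU (sSup 𝒱)) := by
    obtain ⟨K, hK, hVK, hKV⟩ := h𝒱 p.2 p.2.2
    exact IsCompactBox.isWC (.intro (hUB p.1) hK hVK fun x hx s hs => ⟨hx.2, hKV hs⟩)
  refine ⟨Set.range T, Set.countable_range T, Set.forall_mem_range.2 hT,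
    Set.forall_mem_range.2 fun p => (hT p).1, fun U' V' hU' hUV => ?_⟩
  obtain hU'₀ | ⟨x, hx⟩ := (U' : Set X).eq_empty_or_nonempty
  · exact ⟨∅, {V'}, isSaCovering_of_finite Set.finite_empty (by simp)
      (fun x hx => (hU'₀.subset hx).elim), sSup_singleton, by simp⟩
  refine ⟨(U' ⊓ ·) '' ℬ, (V' ⊓ ·) '' 𝒱,
    isSaCovering_image_inf hU' (fun B hB => (hℬ B hB).isSubanalytic) hcover, ?_, ?_⟩
  · rw [sSup_image, ← inf_sSup_eq, inf_eq_left]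
    exact fun s hs => (hUV (Set.mk_mem_prod hx hs)).2
  · rintro _ ⟨B, hB, rfl⟩ _ ⟨V₁, hV₁, rfl⟩
    exact ⟨T (⟨B, hB⟩, ⟨V₁, hV₁⟩), Set.mem_range_self _, fun z hz =>
      ⟨⟨hz.1.2, (hUV (Set.mk_mem_prod hz.1.1 hz.2.1)).1⟩, hz.2.2⟩⟩

theorem exists_countable_cofinal_isWC (W : RelOpen E X S) :
    ∃ 𝒜 : Set (RelOpen E X S), 𝒜.Countable ∧ (∀ A ∈ 𝒜, IsWC A W) ∧
      ∀ A, IsWC A W → ∃ B ∈ 𝒜, A ≤ B := by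
  induction W using RelOpen.induction_on with
  | bot =>
    exact ⟨{⊥}, Set.countable_singleton _, by simpa using isWC_bot ⊥, fun A hA => ⟨⊥, rfl, hA.1⟩⟩
  | box U hU V =>
    obtain ⟨T, hcount, hTW, hT⟩ := exists_countable_isRelCovering_box hU V
    exact hT.exists_countable_cofinal_isWC hcount hTW
  | sup B C hB hC =>
    obtain ⟨ℬ, hℬc, hℬ, hBℬ⟩ := hB
    obtain ⟨𝒞, h𝒞c, h𝒞, hC𝒞⟩ := hC
    refine ⟨Set.image2 (· ⊔ ·) ℬ 𝒞, hℬc.image2 h𝒞c _, ?_, fun A hA => ?_⟩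
    · rintro _ ⟨B', hB', C', hC', rfl⟩
      exact ((hℬ B' hB').mono le_rfl le_sup_left).sup ((h𝒞 C' hC').mono le_rfl le_sup_right)
    · obtain ⟨B', C', hB', hC', hA⟩ := hA.exists_isWC_sup
      obtain ⟨B'', hB'', hBB⟩ := hBℬ B' hB'
      obtain ⟨C'', hC'', hCC⟩ := hC𝒞 C' hC'
      exact ⟨_, Set.mem_image2_of_mem hB'' hC'', hA.1.trans (sup_le_sup hBB hCC)⟩

theorem exists_exhaustion (W : RelOpen E X S) :
    ∃ A : ℕ → RelOpen E X S, (∀ n, IsWC (A n) (A (n + 1))) ∧ (∀ n, IsWC (A n) W) ∧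
      IsRelCovering W (Set.range A) := by
  obtain ⟨𝒜, hcount, h𝒜, hcofinal⟩ := exists_countable_cofinal_isWC W
  obtain ⟨B₀, hB₀, -⟩ := hcofinal ⊥ (isWC_bot W)
  obtain ⟨a, rfl⟩ := hcount.exists_eq_range ⟨B₀, hB₀⟩
  have hstep (B : {B // IsWC B W}) (n : ℕ) : ∃ C : {B // IsWC B W}, IsWC (B.1 ⊔ a n) C.1 := by
    obtain ⟨C, hC, hCW⟩ := (B.2.sup (h𝒜 _ (Set.mem_range_self n))).exists_between
    exact ⟨⟨C, hCW⟩, hC⟩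
  choose next hnext using hstep
  let A : ℕ → {B // IsWC B W} := Nat.rec ⟨⊥, isWC_bot W⟩ fun n B => next B n
  have hA (n) : IsWC ((A n).1 ⊔ a n) (A (n + 1)).1 := hnext (A n) n
  refine ⟨fun n => (A n).1, fun n => (hA n).mono le_sup_left le_rfl, fun n => (A n).2,
    isRelCovering_of_cofinal_isWC (Set.forall_mem_range.2 fun n => (A n).2.1) fun B hB => ?_⟩
  obtain ⟨_, ⟨n, rfl⟩, hBn⟩ := hcofinal B hB
  exact ⟨_, Set.mem_range_self (n + 1), hBn.trans (le_sup_right.trans (hA n).1)⟩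

end Exhaustion

section Sections

variable {E : Type w} [NormedAddCommGroup E] [NormedSpace ℝ E] {X : Type u} [TopologicalSpace X]
  [ChartedSpace E X] {S : Type v} [TopologicalSpace S] {A B C W : RelOpen E X S}
  {F G H : RelSheaf E X S}

namespace RelSheaf

/-- The restriction map `Γ(B; F) → Γ(A; F)` for `A ⊆ B`. -/
def res (F : RelSheaf E X S) (h : A ≤ B) : F.obj.obj (op B) →ₗ[ℂ] F.obj.obj (op A) :=
  (F.obj.map (homOfLE h).op).hom

/-- The map `Γ(A; F) → Γ(A; G)` induced by a morphism of sheaves `F ⟶ G`. -/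
def app (f : F ⟶ G) (A : RelOpen E X S) : F.obj.obj (op A) →ₗ[ℂ] G.obj.obj (op A) :=
  (f.hom.app (op A)).hom

@[simp]
theorem res_res (h : A ≤ B) (h' : B ≤ C) (s : F.obj.obj (op C)) :
    F.res h (F.res h' s) = F.res (h.trans h') s :=
  (ConcreteCategory.congr_hom (F.obj.map_comp (homOfLE h').op (homOfLE h).op) s).symm

@[simp]
theorem res_self (s : F.obj.obj (op A)) : F.res le_rfl s = s :=
  ConcreteCategory.congr_hom (F.obj.map_id (op A)) s

theorem app_res (f : F ⟶ G) (h : A ≤ B) (s : F.obj.obj (op B)) :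
    app f A (F.res h s) = G.res h (app f B s) :=
  ConcreteCategory.congr_hom (f.hom.naturality (homOfLE h).op) s

theorem app_comp (f : F ⟶ G) (g : G ⟶ H) (s : F.obj.obj (op A)) :
    app (f ≫ g) A s = app g A (app f A s) := rfl

theorem app_add (f g : F ⟶ G) (s : F.obj.obj (op A)) :
    app (f + g) A s = app f A s + app g A s := rfl

theorem app_id (s : F.obj.obj (op A)) : app (𝟙 F) A s = s := rfl

theorem app_zero (s : F.obj.obj (op A)) : app (0 : F ⟶ G) A s = 0 := rfl

section Glue

variable {ι : Type*} {D : ι → RelOpen E X S}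

theorem existsUnique_glue (F : RelSheaf E X S) (hD : IsRelCovering W (Set.range D))
    (s : ∀ i, F.obj.obj (op (D i)))
    (hs : ∀ i j B (hi : B ≤ D i) (hj : B ≤ D j), F.res hi (s i) = F.res hj (s j)) :
    ∃! t : F.obj.obj (op W), ∀ i, F.res (hD.1 _ (Set.mem_range_self i)) t = s i := by
  have hF := (isSheaf_iff_isSheaf_of_type _ _).1
    ((Presheaf.isSheaf_iff_isSheaf_forget (relTopology E X S) F.obj
      (forget (ModuleCat.{max u v} ℂ))).1 F.property)
  let incl (i) : D i ⟶ W := homOfLE (hD.1 _ (Set.mem_range_self i))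
  have hgen : Sieve.generate (Presieve.ofArrows D incl) ∈ relTopology E X S W :=
    mem_relTopology_of_isRelCovering hD <| Set.forall_mem_range.2 fun i =>
      ⟨incl i, Sieve.le_generate _ _ _ (Presieve.ofArrows.mk i)⟩
  exact (Presieve.isSheafFor_arrows_iff _ _).1
    ((Presieve.isSheafFor_iff_generate (Presieve.ofArrows D incl)).2 (hF _ hgen)) s
    fun i j Z gi gj _ => hs i j Z (leOfHom gi) (leOfHom gj)

theorem ext_of_isRelCovering (hD : IsRelCovering W (Set.range D)) {t t' : F.obj.obj (op W)}
    (h : ∀ i, F.res (hD.1 _ (Set.mem_range_self i)) t = F.res (hD.1 _ (Set.mem_range_self i)) t') :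
    t = t' :=
  (F.existsUnique_glue hD (fun i => F.res (hD.1 _ (Set.mem_range_self i)) t') (by simp)).unique h
    fun _ => rfl

theorem exists_glue_of_monotone {D : ℕ → RelOpen E X S} (hD : IsRelCovering W (Set.range D))
    (hmono : Monotone D) (s : ∀ n, F.obj.obj (op (D n)))
    (hs : ∀ n, F.res (hmono n.le_succ) (s (n + 1)) = s n) :
    ∃ t : F.obj.obj (op W), ∀ n, F.res (hD.1 _ (Set.mem_range_self n)) t = s n := by
  have hres (m n) (h : m ≤ n) : F.res (hmono h) (s n) = s m := by
    induction n, h using Nat.le_induction with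
    | base => exact res_self _
    | succ n h ih => rw [← ih, ← hs n, res_res]
  refine (F.existsUnique_glue hD s fun i j B hi hj => ?_).exists
  obtain h | h := le_total i j
  · rw [← hres i j h, res_res]
  · rw [← hres j i h, res_res]

variable [T2Space X]

theorem subsingleton_bot (F : RelSheaf E X S) : Subsingleton (F.obj.obj (op ⊥)) :=
  have hbot : IsRelCovering (⊥ : RelOpen E X S) (Set.range (PEmpty.elim : PEmpty.{1} → _)) := by
    rw [Set.range_eq_empty]
    exact_mod_cast isRelCovering_of_finset (T := ∅) (by simp) bot_le
  ⟨fun _ _ => ext_of_isRelCovering hbot nofun⟩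

theorem isRelCovering_cond (A B : RelOpen E X S) :
    IsRelCovering (A ⊔ B) (Set.range fun b => cond b A B) := by
  classical
  rw [Bool.range_eq]
  exact_mod_cast isRelCovering_of_finset (T := {B, A}) (by simp) (by simp [sup_comm])

theorem exists_glue_sup (a : F.obj.obj (op A)) (b : F.obj.obj (op B))
    (h : F.res inf_le_left a = F.res (inf_le_right : A ⊓ B ≤ B) b) :
    ∃ t : F.obj.obj (op (A ⊔ B)), F.res le_sup_left t = a ∧ F.res le_sup_right t = b := by
  have hAB (C) (hA : C ≤ A) (hB : C ≤ B) : F.res hA a = F.res hB b := by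
    simpa using congrArg (F.res (le_inf hA hB)) h
  obtain ⟨t, ht⟩ := (F.existsUnique_glue (isRelCovering_cond A B) (Bool.rec b a) (by
    rintro (_ | _) (_ | _) C hi hj
    exacts [rfl, (hAB C hj hi).symm, hAB C hi hj, rfl])).exists
  exact ⟨t, ht true, ht false⟩

theorem ext_sup {t t' : F.obj.obj (op (A ⊔ B))}
    (hA : F.res le_sup_left t = F.res le_sup_left t')
    (hB : F.res le_sup_right t = F.res le_sup_right t') : t = t' :=
  ext_of_isRelCovering (isRelCovering_cond A B) (Bool.rec hB hA)

end Glue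

end RelSheaf

instance (W : RelOpen E X S) : PreservesFiniteLimits (relSections W) :=
  have : PreservesFiniteLimits ((evaluation (RelOpen E X S)ᵒᵖ (ModuleCat.{max u v} ℂ)).obj
      (op W)) := ⟨fun _ _ _ => inferInstance⟩
  comp_preservesFiniteLimits (sheafToPresheaf (relTopology E X S) (ModuleCat.{max u v} ℂ))
    ((evaluation _ _).obj (op W))

namespace RelSheaf

/-- The section `s` of `G` lifts along `f : F ⟶ G` on the smaller object `A`. -/
def LiftsOn (f : F ⟶ G) (s : G.obj.obj (op W)) (A : RelOpen E X S) : Prop :=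
  ∃ (h : A ≤ W) (t : F.obj.obj (op A)), app f A t = G.res h s

theorem LiftsOn.mono {f : F ⟶ G} {s : G.obj.obj (op W)} (h : LiftsOn f s B) (hAB : A ≤ B) :
    LiftsOn f s A := by
  obtain ⟨hB, t, ht⟩ := h
  exact ⟨hAB.trans hB, F.res hAB t, by rw [app_res, ht, res_res]⟩

theorem exists_sieve_liftsOn (f : F ⟶ G) [Epi f] (s : G.obj.obj (op W)) :
    ∃ R ∈ relTopology E X S W, ∀ ⦃B⦄ (i : B ⟶ W), R i → LiftsOn f s B := by
  have : Sheaf.IsLocallySurjective f := (Sheaf.isLocallySurjective_iff_epi' _ f).2 inferInstance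
  exact ⟨_, Presheaf.imageSieve_mem (relTopology E X S) f.hom (U := op W) s,
    fun B i ⟨t, ht⟩ => ⟨leOfHom i, t, ht⟩⟩

variable {Q : ShortComplex (RelSheaf E X S)}

theorem app_g_app_f (r : Q.X₁.obj.obj (op A)) : app Q.g A (app Q.f A r) = 0 := by
  rw [← app_comp, Q.zero, app_zero]

theorem exists_app_f_eq (hQ : Q.ShortExact) {s : Q.X₂.obj.obj (op A)} (hs : app Q.g A s = 0) :
    ∃ r : Q.X₁.obj.obj (op A), app Q.f A r = s :=
  (ShortComplex.moduleCat_exact_iff (Q.map (relSections A))).1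
    (hQ.exact.map_of_mono_of_preservesKernel (relSections A) hQ.mono_f inferInstance) s hs

end RelSheaf

end Sections

section CSoft

variable {E : Type w} [NormedAddCommGroup E] [NormedSpace ℝ E] [FiniteDimensional ℝ E]
  {X : Type u} [TopologicalSpace X] [ChartedSpace E X] [T2Space X] [IsManifold 𝓘(ℝ, E) ω X]
  {S : Type v} [TopologicalSpace S] [LocallyCompactSpace S] [T2Space S]
  {A B B' C C' W : RelOpen E X S} {F G : RelSheaf E X S} {Q : ShortComplex (RelSheaf E X S)}

open RelSheaf

instance (A : RelOpen E X S) : IsFilteredOrEmpty {U : RelOpen E X S // IsWC A U}ᵒᵖ :=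
  have : IsCodirectedOrder {U : RelOpen E X S // IsWC A U} :=
    ⟨fun U V => ⟨⟨U.1 ⊓ V.1, (U.2.inf V.2).mono (le_inf le_rfl le_rfl) le_rfl⟩,
      (inf_le_left : U.1 ⊓ V.1 ≤ U.1), (inf_le_right : U.1 ⊓ V.1 ≤ V.1)⟩⟩
  inferInstance

theorem surjective_ι_wcSystem_iff (hAW : IsWC A W) :
    Function.Surjective (colimit.ι (wcSystem F A) (op ⟨W, hAW⟩)).hom ↔
      ∀ B, IsWC A B → ∀ t : F.obj.obj (op B), ∃ (s : F.obj.obj (op W)) (C : RelOpen E X S)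
        (hW : C ≤ W) (hB : C ≤ B), IsWC A C ∧ F.res hW s = F.res hB t := by
  have : Nonempty {U : RelOpen E X S // IsWC A U} := ⟨⟨W, hAW⟩⟩
  have : IsFiltered {U : RelOpen E X S // IsWC A U}ᵒᵖ := { }
  refine ⟨fun h B hAB t => ?_, fun h x => ?_⟩
  · obtain ⟨s, hs⟩ := h ((colimit.ι (wcSystem F A) (op ⟨B, hAB⟩)).hom t)
    obtain ⟨C, f, g, hfg⟩ := (Concrete.colimit_rep_eq_iff_exists (wcSystem F A)
      (i := op ⟨W, hAW⟩) (j := op ⟨B, hAB⟩) s t).1 hs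
    exact ⟨s, C.unop.1, leOfHom f.unop, leOfHom g.unop, C.unop.2, hfg⟩
  · obtain ⟨B, t, rfl⟩ := Concrete.colimit_exists_rep (wcSystem F A) x
    obtain ⟨s, C, hW, hB, hAC, hst⟩ := h B.unop.1 B.unop.2 t
    exact ⟨s, (Concrete.colimit_rep_eq_iff_exists (wcSystem F A) (i := op ⟨W, hAW⟩) (j := B) s t).2
      ⟨op ⟨C, hAC⟩, Quiver.Hom.op (homOfLE hW), Quiver.Hom.op (homOfLE hB), hst⟩⟩

theorem isCSoft_iff : IsCSoft F ↔ ∀ ⦃Y A W B : RelOpen E X S⦄, IsWC W Y → ∀ (hAW : IsWC A W)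
    (hAB : IsWC A B) (t : F.obj.obj (op B)),
      ∃ s : F.obj.obj (op W), F.res hAW.le s = F.res hAB.le t := by
  refine ⟨fun h Y A W B hWY hAW hAB t => ?_, fun h Y A W _ hWY hAW => ?_⟩
  · obtain ⟨s, C, hW, hB, hAC, hst⟩ := (surjective_ι_wcSystem_iff hAW).1
      (h Y A W (hAW.mono le_rfl hWY.le) hWY hAW) B hAB t
    exact ⟨s, by simpa using congrArg (F.res hAC.le) hst⟩
  · refine (surjective_ι_wcSystem_iff hAW).2 fun B hAB t => ?_
    obtain ⟨C, hAC, hC⟩ := ((hAW.inf hAB).mono (le_inf le_rfl le_rfl) le_rfl).exists_between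
    obtain ⟨s, hs⟩ := h hWY (hC.mono le_rfl inf_le_left) (hC.mono le_rfl inf_le_right) t
    exact ⟨s, C, _, _, hAC, hs⟩

theorem isCSoft_of_isZero (hF : IsZero F) : IsCSoft F :=
  isCSoft_iff.2 fun _ _ _ _ _ _ _ t => ⟨0, by
    have ht : t = 0 := by rw [← app_id t, hF.eq_of_src (𝟙 F) 0, app_zero]
    rw [ht, map_zero, map_zero]⟩

theorem IsCSoft.biprod (hF : IsCSoft F) (hG : IsCSoft G) : IsCSoft (F ⊞ G) := by
  refine isCSoft_iff.2 fun Y A W B hWY hAW hAB t => ?_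
  obtain ⟨a, ha⟩ := isCSoft_iff.1 hF hWY hAW hAB (app biprod.fst B t)
  obtain ⟨b, hb⟩ := isCSoft_iff.1 hG hWY hAW hAB (app biprod.snd B t)
  refine ⟨app biprod.inl W a + app biprod.inr W b, ?_⟩
  rw [map_add, ← app_res, ← app_res, ha, hb, app_res, app_res, ← app_comp, ← app_comp, ← map_add,
    ← app_add, biprod.total, app_id]

/- Two lifts differ on the intersection by a section `r` of `Q.X₁`; c-softness extends `r` from a
slightly smaller object to `B`, where it is used to correct the first lift. -/
theorem IsCSoft.liftsOn_sup (hQ : Q.ShortExact) (h₁ : IsCSoft Q.X₁) {s : Q.X₃.obj.obj (op W)}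
    (hB : IsWC B B') (hC : IsWC C C') (hB' : LiftsOn Q.g s B') (hC' : LiftsOn Q.g s C') :
    LiftsOn Q.g s (B ⊔ C) := by
  obtain ⟨hBW, b, hb⟩ := hB'
  obtain ⟨hCW, c, hc⟩ := hC'
  obtain ⟨r, hr⟩ := exists_app_f_eq hQ (A := B' ⊓ C')
    (s := Q.X₂.res inf_le_left b - Q.X₂.res inf_le_right c) (by
      rw [map_sub, app_res, app_res, hb, hc, res_res, res_res, sub_self])
  obtain ⟨D, hBD, hD⟩ := hB.exists_between
  obtain ⟨r', hr'⟩ := isCSoft_iff.1 h₁ hD (hBD.mono inf_le_left le_rfl) (hB.inf hC) r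
  obtain ⟨t, htB, htC⟩ := exists_glue_sup (A := B) (B := C)
    (Q.X₂.res hB.le b - app Q.f B (Q.X₁.res hBD.le r')) (Q.X₂.res hC.le c) (by
      rw [map_sub, ← app_res, res_res (F := Q.X₁), hr', app_res, hr]
      simp only [map_sub, res_res, sub_sub_cancel])
  refine ⟨sup_le (hB.le.trans hBW) (hC.le.trans hCW), t, ext_sup ?_ ?_⟩
  · rw [← app_res, htB, map_sub, app_g_app_f, app_res, hb, sub_zero, res_res, res_res]
  · rw [← app_res, htC, app_res, hc, res_res, res_res]

theorem IsCSoft.liftsOn_of_finset (hQ : Q.ShortExact) (h₁ : IsCSoft Q.X₁)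
    {s : Q.X₃.obj.obj (op W)} {T : Finset (RelOpen E X S)} (hT : ∀ B ∈ T, LiftsOn Q.g s B)
    (hA : IsWC A (T.sup id)) : LiftsOn Q.g s A := by
  classical
  induction T using Finset.induction_on generalizing A with
  | empty =>
    have := Q.X₃.subsingleton_bot
    exact LiftsOn.mono ⟨bot_le, 0, Subsingleton.elim _ _⟩ hA.le
  | insert B T _ ih =>
    rw [Finset.sup_insert] at hA
    obtain ⟨hB, hT⟩ := Finset.forall_mem_insert .. |>.1 hT
    obtain ⟨B', C, hB', hC, hA⟩ := hA.exists_isWC_sup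
    obtain ⟨C', hCC', hC'⟩ := hC.exists_between
    exact (h₁.liftsOn_sup hQ hB' hCC' hB (ih hT hC')).mono hA.le

theorem IsCSoft.liftsOn (hQ : Q.ShortExact) (h₁ : IsCSoft Q.X₁) (hA : IsWC A W)
    (s : Q.X₃.obj.obj (op W)) : LiftsOn Q.g s A := by
  have := hQ.epi_g
  obtain ⟨A', hAA', hA'⟩ := hA.exists_between
  obtain ⟨R, hR, hlift⟩ := exists_sieve_liftsOn Q.g s
  obtain ⟨T, hTR, hA'T⟩ := exists_finset_of_mem_relTopology hR hA'
  refine h₁.liftsOn_of_finset hQ (fun B hB => ?_) (hAA'.mono le_rfl hA'T)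
  obtain ⟨i, hi⟩ := hTR B hB
  exact hlift i hi

theorem IsCSoft.quotient (hQ : Q.ShortExact) (h₁ : IsCSoft Q.X₁) (h₂ : IsCSoft Q.X₂) :
    IsCSoft Q.X₃ := by
  refine isCSoft_iff.2 fun Y A W B hWY hAW hAB t => ?_
  obtain ⟨B', hAB', hB'⟩ := hAB.exists_between
  obtain ⟨hB'B, b, hb⟩ := h₁.liftsOn hQ hB' t
  obtain ⟨s, hs⟩ := isCSoft_iff.1 h₂ hWY hAW hAB' b
  exact ⟨app Q.g W s, by rw [← app_res, hs, app_res, hb, res_res]⟩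

theorem IsCSoft.exists_lift_res_eq (hQ : Q.ShortExact) (h₁ : IsCSoft Q.X₁)
    {s : Q.X₃.obj.obj (op W)} (hAB : IsWC A B) (hBC : IsWC B C) (hCW : IsWC C W)
    {b : Q.X₂.obj.obj (op B)} (hb : app Q.g B b = Q.X₃.res (hBC.le.trans hCW.le) s) :
    ∃ c : Q.X₂.obj.obj (op C), app Q.g C c = Q.X₃.res hCW.le s ∧
      Q.X₂.res (hAB.le.trans hBC.le) c = Q.X₂.res hAB.le b := by
  obtain ⟨_, c, hc⟩ := h₁.liftsOn hQ hCW s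
  obtain ⟨r, hr⟩ := exists_app_f_eq hQ (s := b - Q.X₂.res hBC.le c) (by
    rw [map_sub, hb, app_res, hc, res_res, sub_self])
  obtain ⟨r', hr'⟩ := isCSoft_iff.1 h₁ hCW (hAB.mono le_rfl hBC.le) hAB r
  refine ⟨c + app Q.f C r', ?_, ?_⟩
  · rw [map_add, hc, app_g_app_f, add_zero]
  · rw [map_add, ← app_res, hr', app_res, hr, map_sub, res_res, add_sub_cancel]

/- The lifts on `D n` are corrected one after the other so that they agree with their predecessors
two steps further inside, as in the Mittag-Leffler argument. -/
theorem IsCSoft.surjective_of_exhaustion (hQ : Q.ShortExact) (h₁ : IsCSoft Q.X₁)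
    {D : ℕ → RelOpen E X S} (hD : ∀ n, IsWC (D n) (D (n + 1))) (hDW : ∀ n, IsWC (D n) W)
    (hcover : IsRelCovering W (Set.range D)) : Function.Surjective (app Q.g W) := by
  intro s
  have hmono : Monotone D := monotone_nat_of_le_succ fun n => (hD n).le
  let Lift (n : ℕ) := {t : Q.X₂.obj.obj (op (D n)) // app Q.g (D n) t = Q.X₃.res (hDW n).le s}
  have hstep (n) (t : Lift (n + 1)) : ∃ t' : Lift (n + 2),
      Q.X₂.res ((hD n).le.trans (hD (n + 1)).le) t'.1 = Q.X₂.res (hD n).le t.1 := by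
    obtain ⟨t', ht', hres⟩ := h₁.exists_lift_res_eq hQ (hD n) (hD (n + 1)) (hDW (n + 2)) t.2
    exact ⟨⟨t', ht'⟩, hres⟩
  choose next hnext using hstep
  obtain ⟨_, t₀, ht₀⟩ := h₁.liftsOn hQ (hDW 1) s
  let t (n) : Lift (n + 1) := Nat.rec ⟨t₀, ht₀⟩ next n
  obtain ⟨τ, hτ⟩ := exists_glue_of_monotone hcover hmono (fun n => Q.X₂.res (hD n).le (t n).1)
    fun n => (res_res ..).trans (hnext n (t n))
  refine ⟨τ, ext_of_isRelCovering hcover fun n => ?_⟩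
  rw [← app_res, hτ, app_res, (t n).2, res_res]

theorem IsCSoft.shortExact_map_relSections [SecondCountableTopology X]
    [SecondCountableTopology S] (hQ : Q.ShortExact) (h₁ : IsCSoft Q.X₁) (W : RelOpen E X S) :
    (Q.map (relSections W)).ShortExact := by
  obtain ⟨D, hD, hDW, hcover⟩ := exists_exhaustion W
  have := hQ.mono_f
  exact {
    exact := hQ.exact.map_of_mono_of_preservesKernel _ hQ.mono_f inferInstance
    mono_f := inferInstanceAs (Mono ((relSections W).map Q.f))
    epi_g := (ModuleCat.epi_iff_surjective _).2 (h₁.surjective_of_exhaustion hQ hD hDW hcover) }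

end CSoft

section Injective

theorem surjective_map_of_injective {C : Type*} [Category.{w} C] (P : Cᵒᵖ ⥤ Type w) [Injective P]
    {A B : C} (f : A ⟶ B) [Mono f] : Function.Surjective (P.map f.op) := fun s =>
  ⟨yonedaEquiv (Injective.factorThru (yonedaEquiv.symm s) (yoneda.map f)), by
    rw [yonedaEquiv_naturality, Injective.comp_factorThru, Equiv.apply_symm_apply]⟩

/- For every object `M`, the functor `F ↦ Hom(M, F(-))` to presheaves of types preserves injective
objects, because its left adjoint, which sheafifies `U ↦ ∐ M` (over the points of `P(U)`),
preserves monomorphisms. -/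
theorem isSplitEpi_map_of_injective_sheaf {C : Type w} [Category.{w} C]
    {J : GrothendieckTopology C} {D : Type*} [Category.{w} D] [HasCoproducts.{w} D] [MonoCoprod D]
    [HasSheafify J D] (F : Sheaf J D) [Injective F] {A B : C} (f : A ⟶ B) [Mono f] :
    IsSplitEpi (F.obj.map f.op) := by
  let M := F.obj.obj (op A)
  have adj := ((sigmaConstAdj M).whiskerRight Cᵒᵖ).comp (sheafificationAdjunction J D)
  have : Injective (F.obj ⋙ coyoneda.obj (op M)) := adj.map_injective F inferInstance
  obtain ⟨s, hs⟩ := surjective_map_of_injective (F.obj ⋙ coyoneda.obj (op M)) f (𝟙 M)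
  exact ⟨⟨s, hs⟩⟩

variable {E : Type w} [NormedAddCommGroup E] [NormedSpace ℝ E]
  {X : Type u} [TopologicalSpace X] [ChartedSpace E X] {S : Type v} [TopologicalSpace S]

theorem RelSheaf.surjective_res_of_injective (F : RelSheaf E X S) [Injective F]
    {A B : RelOpen E X S} (h : A ≤ B) : Function.Surjective (F.res h) :=
  have := isSplitEpi_map_of_injective_sheaf F (homOfLE h)
  (ModuleCat.epi_iff_surjective (F.obj.map (homOfLE h).op)).1 inferInstance

theorem isCSoft_of_injective [FiniteDimensional ℝ E] [T2Space X] [IsManifold 𝓘(ℝ, E) ω X]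
    [LocallyCompactSpace S] [T2Space S] (F : RelSheaf E X S) [Injective F] : IsCSoft F :=
  isCSoft_iff.2 fun Y A W B _ hAW hAB t => by
    obtain ⟨s, hs⟩ := F.surjective_res_of_injective inf_le_left
      (F.res (inf_le_right : W ⊓ B ≤ B) t)
    exact ⟨s, by simpa using congrArg (F.res (le_inf hAW.le hAB.le)) hs⟩

end Injective

section Acyclic

variable {C : Type*} [Category C] [Abelian C] {D : Type*} [Category D] [Abelian D]

theorem IsInjectiveWrt.of_iso {P : ObjectProperty C} {Φ : C ⥤ D} [Φ.Additive]
    (h : IsInjectiveWrt P Φ) {A B : C} (e : A ≅ B) (hA : P A) : P B :=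
  h.quotient (ShortComplex.mk (0 : (0 : C) ⟶ A) e.hom zero_comp)
    { exact := (ShortComplex.exact_iff_mono _ rfl).2 (inferInstanceAs (Mono e.hom))
      mono_f := inferInstanceAs (Mono (0 : (0 : C) ⟶ A))
      epi_g := inferInstanceAs (Epi e.hom) } h.zero hA

theorem kernel_ι_comp_kernel_lift (T : ShortComplex C) :
    kernel.ι T.f ≫ kernel.lift T.g T.f T.zero = 0 := by
  simp [← cancel_mono (kernel.ι T.g)]

theorem shortExact_kernel_ι_kernel_lift {T : ShortComplex C} (hT : T.Exact) :
    (ShortComplex.mk _ _ (kernel_ι_comp_kernel_lift T)).ShortExact where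
  exact := ShortComplex.exact_of_f_is_kernel _ (isKernelOfComp (kernel.ι T.g) T.f
    (kernelIsKernel T.f) (kernel_ι_comp_kernel_lift T) (kernel.lift_ι _ _ _))
  epi_g := T.exact_iff_epi_kernel_lift.1 hT

theorem exact_map_of_epi_map_kernel_lift (Φ : C ⥤ D) [Φ.Additive] [PreservesFiniteLimits Φ]
    (T : ShortComplex C) (hT : Epi (Φ.map (kernel.lift T.g T.f T.zero))) : (T.map Φ).Exact := by
  have hker := (ShortComplex.exact_kernel T.g).map_of_mono_of_preservesKernel Φ
    (inferInstanceAs (Mono (kernel.ι T.g))) inferInstance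
  let φ : T.map Φ ⟶ (ShortComplex.mk _ _ (kernel.condition T.g)).map Φ :=
    { τ₁ := Φ.map (kernel.lift T.g T.f T.zero)
      τ₂ := 𝟙 (Φ.obj T.X₂)
      τ₃ := 𝟙 (Φ.obj T.X₃)
      comm₁₂ := ((Φ.map_comp _ _).symm.trans (congrArg Φ.map (kernel.lift_ι _ _ _))).trans
        (Category.comp_id _).symm
      comm₂₃ := (Category.id_comp _).trans (Category.comp_id _).symm }
  have : Epi φ.τ₁ := hT
  have : IsIso φ.τ₂ := inferInstanceAs (IsIso (𝟙 _))
  have : Mono φ.τ₃ := inferInstanceAs (Mono (𝟙 _))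
  exact (ShortComplex.exact_iff_of_epi_of_isIso_of_mono φ).2 hker

/- By induction, all the kernels in an injective resolution of `A` satisfy `P`, so `Φ` preserves
the exactness of the sequences `0 → Zⁿ → Iⁿ → Zⁿ⁺¹ → 0`. -/
theorem IsInjectiveWrt.isZero_rightDerived [HasInjectiveResolutions C] {P : ObjectProperty C}
    {Φ : C ⥤ D} [Φ.Additive] [PreservesFiniteLimits Φ] (h : IsInjectiveWrt P Φ)
    (hI : ∀ A : C, Injective A → P A) {A : C} (hA : P A) (n : ℕ) :
    IsZero ((Φ.rightDerived (n + 1)).obj A) := by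
  let I := injectiveResolution A
  have hP (n) : P (kernel (I.cocomplex.d n (n + 1))) := by
    induction n with
    | zero => exact h.of_iso (IsLimit.conePointUniqueUpToIso I.isLimitKernelFork
        (limit.isLimit (parallelPair (I.cocomplex.d 0 1) 0))) hA
    | succ n ih =>
      exact h.quotient _ (shortExact_kernel_ι_kernel_lift (I.exact_succ n)) ih
        (hI _ (I.injective n))
  refine IsZero.of_iso ?_ (I.isoRightDerivedObj Φ (n + 1))
  rw [HomologicalComplex.homologyFunctor_obj, ← HomologicalComplex.exactAt_iff_isZero_homology,
    HomologicalComplex.exactAt_iff' _ n (n + 1) (n + 2) (by simp) (by simp)]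
  exact exact_map_of_epi_map_kernel_lift Φ (ShortComplex.mk _ _ (I.complex_d_comp n))
    (h.exact _ (shortExact_kernel_ι_kernel_lift (I.exact_succ n)) (hP n)).epi_g

end Acyclic

theorem mainTheorem6_general {E : Type*} [NormedAddCommGroup E] [NormedSpace ℝ E]
    [FiniteDimensional ℝ E] {X : Type u} [TopologicalSpace X] [T2Space X]
    [SecondCountableTopology X] [ChartedSpace E X] [IsManifold 𝓘(ℝ, E) ω X]
    {S : Type v} [TopologicalSpace S] [T2Space S] [SecondCountableTopology S]
    [LocallyCompactSpace S] (W : RelOpen E X S) :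
    IsInjectiveWrt (fun F : RelSheaf E X S => IsCSoft F) (relSections W) ∧
    ∀ F : RelSheaf E X S, IsCSoft F → ∀ n : ℕ, 1 ≤ n →
      IsZero (((relSections W).rightDerived n).obj F) := by
  have h : IsInjectiveWrt (fun F : RelSheaf E X S => IsCSoft F) (relSections W) :=
    { zero := isCSoft_of_isZero (isZero_zero _)
      biprod := fun _ _ => IsCSoft.biprod
      cogenerating := fun F =>
        ⟨Injective.under F, Injective.ι F, isCSoft_of_injective _, inferInstance⟩
      quotient := fun _ => IsCSoft.quotient
      exact := fun _ hQ h₁ => h₁.shortExact_map_relSections hQ W }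
  refine ⟨h, fun F hF n hn => ?_⟩
  obtain ⟨n, rfl⟩ := Nat.exists_eq_add_of_le' hn
  exact h.isZero_rightDerived (fun F _ => isCSoft_of_injective F) hF n

theorem mainTheorem6
    {E : Type*} [NormedAddCommGroup E] [NormedSpace ℝ E] [FiniteDimensional ℝ E]
    {E' : Type*} [NormedAddCommGroup E'] [NormedSpace ℝ E'] [FiniteDimensional ℝ E']
    (X : Type u) [TopologicalSpace X] [T2Space X] [SecondCountableTopology X]
    [ChartedSpace E X] [IsManifold 𝓘(ℝ, E) ω X]
    (S : Type v) [TopologicalSpace S] [T2Space S] [SecondCountableTopology S]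
    [ChartedSpace E' S] [IsManifold 𝓘(ℝ, E') ω S]
    (U : Opens X) (hU : IsSubanalytic E (U : Set X)) (V : Opens S) :
    IsInjectiveWrt (fun F : RelSheaf E X S => IsCSoft F) (relSections (RelOpen.box E U hU V)) ∧
    ∀ F : RelSheaf E X S, IsCSoft F → ∀ n : ℕ, 1 ≤ n →
      IsZero (((relSections (RelOpen.box E U hU V)).rightDerived n).obj F) :=
  have := FiniteDimensional.proper ℝ E'
  have := ChartedSpace.locallyCompactSpace E' S
  mainTheorem6_general (RelOpen.box E U hU V)
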